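/- **Conventions.** A *partial group* $\mathcal P$ is a set $\mathcal P_1$ with sets $\mathcal P_n\subseteq \mathcal P_1^{\,n}$ ($n\ge 1$) of composable words and products $\triangledown_n:\mathcal P_n\to\mathcal P_1$ ($\triangledown_1=\mathrm{id}$), a unit $1$ and an inversion such that: deleting the first or the last letter of a composable word (of length $\ge 2$) leaves a composable word; replacing a non-empty subword by its product gives a composable word with the same product; inserting $1$ gives a composable word, and $\triangledown_2(1,\pi)=\triangledown_2(\pi,1)=\pi$; for $\boldsymbol\pi=(\pi_1,\dots,\pi_n)\in\mathcal P_n$ and $\boldsymbol\pi^{-1}=(\pi_n^{-1},\dots,\pi_1^{-1})$ both concatenations of $\boldsymbol\pi$ and $\boldsymbol\pi^{-1}$ are composable, and $\triangledown_2(\pi,\pi^{-1})=\triangledown_2(\pi^{-1},\pi)=1$. An isomorphism is a bijection that, with its inverse, preserves composable words and products. A *congruence* is an equivalence relation $\sim$ on $\mathcal P_1$ compatible with products of composable words of equal length and with inversion; $\mathcal P/\!\sim$ has as composable words the words of classes of composable words, with the induced products. The Euclidean group $E(d)$ and its subgroup $M(d)$ of orientation preserving isometries act on $\mathbb R^d$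 from the right; $O(d)\le E(d)$ is the orthogonal group. For $K\subseteq\mathbb R^d$ put $G(K)=\{a\in E(d): Ka=K\}$ and $SG(K)=G(K)\cap M(d)$. For a non-empty $F\subseteq\mathbb R^d$ let $cc(F)$ be the set of its connected components. The partial group $\mathcal P(F)$ has as composable words the $(\pi_1,\dots,\pi_n)\in E(d)^n$ for which there is $K\in cc(F)$ with $K\pi_1,\ K\pi_1\pi_2,\dots,\ K\pi_1\cdots\pi_n\in cc(F)$, with product $\pi_1\cdots\pi_n$; $S\mathcal P(F)$ is defined in the same way with $M(d)$ in place of $E(d)$. For a non-empty $P\subseteq\mathbb R^d$, $\mathcal V(P)$ is the partial group with composable words $(x_1-x_0,\,x_2-x_1,\dots,x_n-x_{n-1})$, $x_0,\dots,x_n\in P$, and product $x_n-x_0$. For a group $G$, $\bigvee_P G$ is the wedge of copies of $G$ indexed by $P$: its elements are the $[x,a]$ ($x\in P$, $a\in G$), where all $[x,1]$ are identified with the unit and there are no other identifications, and its composable words are the $([x,a_1],\dots,[x,a_n])$, with product $[x,a_1\cdots a_n]$. $\mathcal V(P)$ acts on $\bigvee_P G$ by $$([x_0,a_1],\dots,[x_0,a_r])\lhd(x_1-x_0,\dots,x_n-x_{n-1})=([x_n,a_1],\dots,[x_n,a_r]).$$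 The semidirect product $\mathcal V(P)\ltimes\bigvee_P G$ for this action consists of the pairs $\gamma\ltimes\eta\in\mathcal V(P)_1\times(\bigvee_P G)_1$ for which $\eta\lhd\gamma^{-1}$ is defined, that is, of the elements $(y-x)\ltimes[y,a]$ with $x,y\in P$, $a\in G$. A word $\boldsymbol\alpha=(\gamma_i\ltimes\eta_i)_{1\le i\le n}$ is composable if the entries of $$A(\boldsymbol\alpha)=(\eta_1\lhd(\gamma_2,\dots,\gamma_n),\ \eta_2\lhd(\gamma_3,\dots,\gamma_n),\dots,\ \eta_n)$$ are defined and $A(\boldsymbol\alpha)\lhd(\gamma_n^{-1},\dots,\gamma_1^{-1})$ is defined; its product is $\triangledown(\gamma_1,\dots,\gamma_n)\ltimes\triangledown(A(\boldsymbol\alpha))$. **Theorem.** Let $F\subseteq\mathbb R^d$ be non-empty and let $F_0,P\subseteq\mathbb R^d$ be such that $cc(F)=\{F_0+x\mid x\in P\}$. Assume that $G(F_0)$ is a subgroup of $O(d)$. Then there are congruences $\sim$ on $\mathcal V(P)\ltimes\bigvee_P G(F_0)$ and on $\mathcal V(P)\ltimes\bigvee_P SG(F_0)$ such that $$\mathcal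 P(F)\cong\Bigl(\mathcal V(P)\ltimes{\bigvee}_P G(F_0)\Bigr)/\!\sim,\qquad S\mathcal P(F)\cong\Bigl(\mathcal V(P)\ltimes{\bigvee}_P SG(F_0)\Bigr)/\!\sim$$ as partial groups. In both cases $\sim$ is given, for $x,y,x',y'\in P$ and $a,a'$ in $G(F_0)$, respectively $SG(F_0)$, by $$(y-x)\ltimes[y,a]\ \sim\ (y'-x')\ltimes[y',a']\iff a=a'\ \text{ and }\ (x'-x)a=y'-y.$$ -/

import Mathlib

open scoped Pointwise RightActions

universe u v w

/-- A partial group: a set of elements, a set `dom` of words of positive length (those which may be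
multiplied), a multiplication of such words, a unit and an inversion.
`prod` is a total function for convenience; its values outside `dom` carry no meaning. -/
structure PartialGroup where
  carrier : Type u
  dom : Set (List carrier)
  prod : List carrier → carrier
  one : carrier
  inv : carrier → carrier
  ne_nil : ∀ {w}, w ∈ dom → w ≠ []
  singleton_mem : ∀ a, [a] ∈ dom
  prod_singleton : ∀ a, prod [a] = a
  tail_mem : ∀ a w, w ≠ [] → a :: w ∈ dom → w ∈ dom
  init_mem : ∀ w a, w ≠ [] → w ++ [a] ∈ dom → w ∈ dom
  collapse_mem : ∀ u v w, v ≠ [] → u ++ v ++ w ∈ dom → u ++ prod v :: w ∈ dom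
  collapse_prod : ∀ u v w, v ≠ [] → u ++ v ++ w ∈ dom →
    prod (u ++ prod v :: w) = prod (u ++ v ++ w)
  insert_one : ∀ u v, u ++ v ∈ dom → u ++ one :: v ∈ dom
  one_prod : ∀ a, prod [one, a] = a
  prod_one : ∀ a, prod [a, one] = a
  append_inv : ∀ w, w ∈ dom → w ++ (w.map inv).reverse ∈ dom
  inv_append : ∀ w, w ∈ dom → (w.map inv).reverse ++ w ∈ dom
  prod_inv : ∀ a, prod [a, inv a] = one
  inv_prod : ∀ a, prod [inv a, a] = one

namespace PartialGroup

/-- The set of composable words of length `n`. -/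
def words (P : PartialGroup.{u}) (n : ℕ) : Set (List P.carrier) :=
  {w | w ∈ P.dom ∧ w.length = n}

/-- The inverse `(aₙ⁻¹, …, a₁⁻¹)` of a word `(a₁, …, aₙ)`. -/
def invWord (P : PartialGroup.{u}) (w : List P.carrier) : List P.carrier :=
  (w.map P.inv).reverse

/-- Maps of partial groups. -/
def IsMap (Q : PartialGroup.{u}) (P : PartialGroup.{v}) (φ : Q.carrier → P.carrier) : Prop :=
  ∀ w ∈ Q.dom, w.map φ ∈ P.dom ∧ P.prod (w.map φ) = φ (Q.prod w)

/-- Isomorphisms of partial groups: bijections which, together with their inverses,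
are maps of partial groups. -/
structure Iso (Q : PartialGroup.{u}) (P : PartialGroup.{v}) where
  toEquiv : Q.carrier ≃ P.carrier
  isMap : IsMap Q P toEquiv
  isMap_symm : IsMap P Q toEquiv.symm

/-- Partial group congruences. -/
structure Congruence (P : PartialGroup.{u}) where
  r : P.carrier → P.carrier → Prop
  equiv : Equivalence r
  prod_rel : ∀ w w', w ∈ P.dom → w' ∈ P.dom → List.Forall₂ r w w' → r (P.prod w) (P.prod w')
  inv_rel : ∀ a b, r a b → r (P.inv a) (P.inv b)

section basic
variable (P : PartialGroup.{u})

theorem left_mem (a b : List P.carrier) (ha : a ≠ []) (h : a ++ b ∈ P.dom) : a ∈ P.dom := by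
  induction b using List.reverseRecOn with
  | nil => simpa using h
  | append_singleton b x ih =>
    exact ih (P.init_mem (a ++ b) x (by simp [ha]) (by simpa using h))

theorem right_mem (a b : List P.carrier) (hb : b ≠ []) (h : a ++ b ∈ P.dom) : b ∈ P.dom := by
  induction a with
  | nil => simpa using h
  | cons x a ih => exact ih (P.tail_mem x (a ++ b) (by simp [hb]) (by simpa using h))

theorem inv_inv (a : P.carrier) : P.inv (P.inv a) = a := by
  have h1 := P.append_inv _ (P.singleton_mem a)
  have h2 := P.append_inv _ h1
  have h3 : [a, P.inv a, P.inv (P.inv a)] ∈ P.dom :=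
    P.left_mem _ [P.inv a] (by simp) (by simpa using h2)
  have e1 := P.collapse_prod [] [a, P.inv a] [P.inv (P.inv a)] (by simp) (by simpa using h3)
  have e2 := P.collapse_prod [a] [P.inv a, P.inv (P.inv a)] [] (by simp) (by simpa using h3)
  simp only [List.nil_append, List.cons_append, P.prod_inv, P.one_prod, P.prod_one] at e1 e2
  exact e1.trans e2.symm

theorem inv_unique (a b : P.carrier) (h : [a, b] ∈ P.dom) (hp : P.prod [a, b] = P.one) :
    b = P.inv a := by
  have h2 := P.inv_append _ h
  have h3 : [P.inv a, a, b] ∈ P.dom :=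
    P.right_mem [P.inv b] _ (by simp) (by simpa using h2)
  have e1 := P.collapse_prod [] [P.inv a, a] [b] (by simp) (by simpa using h3)
  have e2 := P.collapse_prod [P.inv a] [a, b] [] (by simp) (by simpa using h3)
  simp only [List.nil_append, List.cons_append, P.inv_prod, hp, P.one_prod, P.prod_one] at e1 e2
  exact e1.trans e2.symm

theorem inv_one : P.inv P.one = P.one :=
  (P.inv_unique P.one P.one (P.insert_one [] [P.one] (P.singleton_mem _)) (P.one_prod _)).symm

theorem invWord_invWord (w : List P.carrier) : P.invWord (P.invWord w) = w := by
  simp [invWord, List.map_reverse, Function.comp_def, P.inv_inv]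

theorem invWord_ne_nil {w : List P.carrier} (h : w ≠ []) : P.invWord w ≠ [] := by
  simpa [invWord] using h

theorem invWord_append (a b : List P.carrier) :
    P.invWord (a ++ b) = P.invWord b ++ P.invWord a := by
  simp [invWord]

theorem invWord_mem {w : List P.carrier} (h : w ∈ P.dom) : P.invWord w ∈ P.dom :=
  P.right_mem w _ (P.invWord_ne_nil (P.ne_nil h)) (P.append_inv w h)

theorem prod_insert_one (a b : List P.carrier) (h : a ++ b ∈ P.dom) :
    P.prod (a ++ P.one :: b) = P.prod (a ++ b) := by
  have h' := P.insert_one a b h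
  rcases List.eq_nil_or_concat a with rfl | ⟨a', x, rfl⟩
  · cases b with
    | nil => exact absurd rfl (P.ne_nil h)
    | cons y b =>
      have := P.collapse_prod [] [P.one, y] b (by simp) (by simpa using h')
      simpa [P.one_prod] using this.symm
  · have := P.collapse_prod a' [x, P.one] b (by simp) (by simpa using h')
    simpa [P.prod_one] using this.symm

theorem prod_append_invWord (w : List P.carrier) (h : w ∈ P.dom) :
    P.prod (w ++ P.invWord w) = P.one := by
  induction w using List.reverseRecOn with
  | nil => exact absurd rfl (P.ne_nil h)
  | append_singleton a x ih =>
    have h1 : a ++ [x, P.inv x] ++ P.invWord a ∈ P.dom := by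
      simpa [invWord] using P.append_inv _ h
    have e1 := P.collapse_prod a [x, P.inv x] (P.invWord a) (by simp) h1
    rw [P.prod_inv] at e1
    have e3 : a ++ [x] ++ P.invWord (a ++ [x]) = a ++ [x, P.inv x] ++ P.invWord a := by
      simp [invWord]
    rw [e3, ← e1]
    by_cases ha : a = []
    · subst ha; simpa [invWord] using P.prod_singleton _
    · have had := P.left_mem a [x] ha h
      exact (P.prod_insert_one a _ (P.append_inv a had)).trans (ih had)

theorem prod_invWord (w : List P.carrier) (h : w ∈ P.dom) :
    P.prod (P.invWord w) = P.inv (P.prod w) := by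
  have hn := P.ne_nil h
  have hi := P.invWord_ne_nil hn
  have h0 : w ++ P.invWord w ∈ P.dom := P.append_inv w h
  have h1 := P.collapse_mem [] w (P.invWord w) hn (by simpa using h0)
  have e1 := P.collapse_prod [] w (P.invWord w) hn (by simpa using h0)
  have h2 := P.collapse_mem [P.prod w] (P.invWord w) [] hi (by simpa using h1)
  have e2 := P.collapse_prod [P.prod w] (P.invWord w) [] hi (by simpa using h1)
  apply P.inv_unique _ _ (by simpa using h2)
  simp only [List.nil_append, List.append_nil, List.singleton_append] at e1 e2
  rw [e2, e1, P.prod_append_invWord w h]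

end basic

namespace Congruence
variable {P : PartialGroup.{u}} (c : P.Congruence)

/-- The congruence as a setoid. -/
def setoid : Setoid P.carrier := ⟨c.r, c.equiv⟩

/-- The class `[a]` of an element. -/
def cls (a : P.carrier) : Quotient c.setoid := Quotient.mk c.setoid a

theorem cls_eq {a b : P.carrier} : c.cls a = c.cls b ↔ c.r a b := Quotient.eq (r := c.setoid)

theorem map_cls_eq {w w' : List P.carrier} :
    w.map c.cls = w'.map c.cls ↔ List.Forall₂ c.r w w' := by
  rw [← List.forall₂_eq_eq_eq, List.forall₂_map_left_iff, List.forall₂_map_right_iff]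
  simp only [c.cls_eq]

open Classical in
/-- The product of a word of classes: the class of the product of a composable word of
representatives. -/
noncomputable def qprod (w : List (Quotient c.setoid)) : Quotient c.setoid :=
  if h : ∃ t ∈ P.dom, t.map c.cls = w then c.cls (P.prod h.choose) else c.cls P.one

theorem qprod_map {t : List P.carrier} (ht : t ∈ P.dom) :
    c.qprod (t.map c.cls) = c.cls (P.prod t) := by
  have h : ∃ t' ∈ P.dom, t'.map c.cls = t.map c.cls := ⟨t, ht, rfl⟩
  rw [qprod, dif_pos h, c.cls_eq]
  exact c.prod_rel _ _ h.choose_spec.1 ht (c.map_cls_eq.1 h.choose_spec.2)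

/-- Inversion on classes. -/
def qinv : Quotient c.setoid → Quotient c.setoid :=
  Quotient.map P.inv (fun a b h => c.inv_rel a b h)

theorem qinv_cls (a : P.carrier) : c.qinv (c.cls a) = c.cls (P.inv a) := rfl

theorem map_qinv (t : List P.carrier) : (t.map c.cls).map c.qinv = (t.map P.inv).map c.cls := by
  simp [Function.comp_def, qinv_cls]

/-- The quotient of a partial group by a congruence: the composable words are the words of classes
of the composable words. -/
@[reducible] noncomputable def quotient : PartialGroup.{u} where
  carrier := Quotient c.setoid
  dom := {w | ∃ t ∈ P.dom, t.map c.cls = w}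
  prod := c.qprod
  one := c.cls P.one
  inv := c.qinv
  ne_nil := by
    rintro w ⟨t, ht, rfl⟩
    simpa using P.ne_nil ht
  singleton_mem := by
    intro a
    induction a using Quotient.inductionOn with
    | h a => exact ⟨[a], P.singleton_mem a, rfl⟩
  prod_singleton := by
    intro a
    induction a using Quotient.inductionOn with
    | h a =>
      have := c.qprod_map (P.singleton_mem a)
      rw [P.prod_singleton] at this
      exact this
  tail_mem := by
    rintro a w hw ⟨t, ht, h⟩
    obtain ⟨b, t, rfl, rfl, rfl⟩ := List.map_eq_cons_iff.1 h
    exact ⟨t, P.tail_mem b t (by simpa using hw) ht, rfl⟩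
  init_mem := by
    rintro w a hw ⟨t, ht, h⟩
    obtain ⟨s, t, rfl, rfl, -⟩ := List.map_eq_append_iff.1 h
    exact ⟨s, P.left_mem s t (by simpa using hw) ht, rfl⟩
  collapse_mem := by
    rintro a b d hb ⟨t, ht, h⟩
    obtain ⟨t', s₃, rfl, h', rfl⟩ := List.map_eq_append_iff.1 h
    obtain ⟨s₁, s₂, rfl, rfl, rfl⟩ := List.map_eq_append_iff.1 h'
    have hs : s₂ ≠ [] := by simpa using hb
    refine ⟨_, P.collapse_mem s₁ s₂ s₃ hs ht, ?_⟩
    rw [c.qprod_map (P.right_mem s₁ s₂ hs (P.left_mem _ s₃ (by simp [hs]) ht))]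
    simp
  collapse_prod := by
    rintro a b d hb ⟨t, ht, h⟩
    obtain ⟨t', s₃, rfl, h', rfl⟩ := List.map_eq_append_iff.1 h
    obtain ⟨s₁, s₂, rfl, rfl, rfl⟩ := List.map_eq_append_iff.1 h'
    have hs : s₂ ≠ [] := by simpa using hb
    rw [c.qprod_map (P.right_mem s₁ s₂ hs (P.left_mem _ s₃ (by simp [hs]) ht))]
    have h1 := c.qprod_map (P.collapse_mem s₁ s₂ s₃ hs ht)
    have h2 := c.qprod_map ht
    rw [P.collapse_prod s₁ s₂ s₃ hs ht] at h1
    simp only [List.map_append, List.map_cons] at h1 h2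
    rw [h1, h2]
  insert_one := by
    rintro a b ⟨t, ht, h⟩
    obtain ⟨s₁, s₂, rfl, rfl, rfl⟩ := List.map_eq_append_iff.1 h
    exact ⟨_, P.insert_one s₁ s₂ ht, by simp⟩
  one_prod := by
    intro a
    induction a using Quotient.inductionOn with
    | h a =>
      have := c.qprod_map (P.insert_one [] [a] (P.singleton_mem a))
      simp only [List.nil_append] at this
      rw [P.one_prod] at this
      exact this
  prod_one := by
    intro a
    induction a using Quotient.inductionOn with
    | h a =>
      have := c.qprod_map (P.insert_one [a] [] (P.singleton_mem a))
      simp only [List.singleton_append] at this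
      rw [P.prod_one] at this
      exact this
  append_inv := by
    rintro w ⟨t, ht, rfl⟩
    exact ⟨_, P.append_inv t ht, by rw [map_qinv]; simp [List.map_reverse]⟩
  inv_append := by
    rintro w ⟨t, ht, rfl⟩
    exact ⟨_, P.inv_append t ht, by rw [map_qinv]; simp [List.map_reverse]⟩
  prod_inv := by
    intro a
    induction a using Quotient.inductionOn with
    | h a =>
      have := c.qprod_map (P.append_inv [a] (P.singleton_mem a))
      simp only [List.map_cons, List.map_nil, List.reverse_singleton,
        List.singleton_append] at this
      rw [P.prod_inv] at this
      exact this
  inv_prod := by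
    intro a
    induction a using Quotient.inductionOn with
    | h a =>
      have := c.qprod_map (P.inv_append [a] (P.singleton_mem a))
      simp only [List.map_cons, List.map_nil, List.reverse_singleton,
        List.singleton_append] at this
      rw [P.inv_prod] at this
      exact this

end Congruence

/-- `X` is a right `F`-set: `dom x γ` says that the word `γ` may act on `x`, and `act x γ` is then
the result. (Values of `dom` and `act` outside `X` and of `act` outside `dom` carry no meaning; the
empty word acts as the identity, by convention.) -/
structure IsPSet (F : PartialGroup.{u}) {α : Type v} (X : Set α)
    (dom : α → List F.carrier → Prop) (act : α → List F.carrier → α) : Prop where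
  nonempty : X.Nonempty
  word_mem : ∀ x ∈ X, ∀ γ, dom x γ → γ ≠ [] → γ ∈ F.dom
  act_mem : ∀ x ∈ X, ∀ γ, dom x γ → act x γ ∈ X
  nil_dom : ∀ x ∈ X, dom x []
  nil_act : ∀ x ∈ X, act x [] = x
  init_dom : ∀ x ∈ X, ∀ γ a, dom x (γ ++ [a]) → dom x γ
  act_dom : ∀ x ∈ X, ∀ γ δ, dom x (γ ++ δ) → dom (act x γ) δ
  act_act : ∀ x ∈ X, ∀ γ δ, dom x (γ ++ δ) → act (act x γ) δ = act x (γ ++ δ)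
  collapse_dom : ∀ x ∈ X, ∀ β γ δ, γ ≠ [] → dom x (β ++ γ ++ δ) → dom x (β ++ F.prod γ :: δ)
  collapse_act : ∀ x ∈ X, ∀ β γ δ, γ ≠ [] → dom x (β ++ γ ++ δ) →
    act x (β ++ F.prod γ :: δ) = act x (β ++ γ ++ δ)
  insert_one : ∀ x ∈ X, ∀ γ δ, dom x (γ ++ δ) → dom x (γ ++ F.one :: δ)
  act_one : ∀ x ∈ X, act x [F.one] = x
  append_inv : ∀ x ∈ X, ∀ γ, dom x γ → dom x (γ ++ F.invWord γ)

/-- Maps of `F`-sets. -/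
def IsPSetMap (F : PartialGroup.{u}) {α : Type v} {β : Type w} (X : Set α)
    (dom : α → List F.carrier → Prop) (act : α → List F.carrier → α) (Y : Set β)
    (dom' : β → List F.carrier → Prop) (act' : β → List F.carrier → β) (f : α → β) : Prop :=
  Set.MapsTo f X Y ∧
    ∀ x ∈ X, ∀ γ, dom x γ → dom' (f x) γ ∧ act' (f x) γ = f (act x γ)

/-- An `F`-set is friendly if every composable word of `F` acts on at least one element. -/
def Friendly (F : PartialGroup.{u}) {α : Type v} (X : Set α)
    (dom : α → List F.carrier → Prop) : Prop :=
  ∀ γ ∈ F.dom, ∃ x ∈ X, dom x γ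

/-- A (right) action of the partial group `F` on the partial group `H`, making `H` an
`F`-partial group: every `H_r` is an `F`-set, and the structure maps of `H` are maps of
`F`-sets. -/
structure Action (F : PartialGroup.{u}) (H : PartialGroup.{v}) where
  dom : List H.carrier → List F.carrier → Prop
  act : List H.carrier → List F.carrier → List H.carrier
  dom_mem : ∀ {η γ}, dom η γ → η ∈ H.dom
  isPSet : ∀ r > 0, IsPSet F (H.words r) dom act
  tail_map : ∀ r > 0, IsPSetMap F (H.words (r + 1)) dom act (H.words r) dom act List.tail
  init_map : ∀ r > 0, IsPSetMap F (H.words (r + 1)) dom act (H.words r) dom act List.dropLast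
  collapse_map : ∀ p q r, q > 0 → IsPSetMap F (H.words (p + q + r)) dom act
    (H.words (p + 1 + r)) dom act
    (fun η => η.take p ++ H.prod ((η.drop p).take q) :: η.drop (p + q))
  insert_one_map : ∀ r > 0, ∀ i ≤ r, IsPSetMap F (H.words r) dom act (H.words (r + 1)) dom act
    (fun η => η.take i ++ H.one :: η.drop i)
  one_dom : ∀ γ ∈ F.dom, dom [H.one] γ
  one_act : ∀ γ ∈ F.dom, act [H.one] γ = [H.one]
  append_inv_map : ∀ r > 0, IsPSetMap F (H.words r) dom act (H.words (2 * r)) dom act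
    (fun η => η ++ H.invWord η)
  inv_append_map : ∀ r > 0, IsPSetMap F (H.words r) dom act (H.words (2 * r)) dom act
    (fun η => H.invWord η ++ η)


namespace Action
variable {F : PartialGroup.{u}} {H : PartialGroup.{v}} (K : Action F H)

/-- The action `η ◁ γ` on a single letter. -/
def letter (η : H.carrier) (γ : List F.carrier) : H.carrier := (K.act [η] γ).headD H.one

theorem mem_one (x : H.carrier) : [x] ∈ H.words 1 := ⟨H.singleton_mem x, rfl⟩

theorem mem_words {η γ} (h : K.dom η γ) : η ∈ H.words η.length := ⟨K.dom_mem h, rfl⟩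

theorem length_pos {η γ} (h : K.dom η γ) : 0 < η.length :=
  List.length_pos_iff.2 (H.ne_nil (K.dom_mem h))

theorem length_act {η γ} (h : K.dom η γ) : (K.act η γ).length = η.length :=
  ((K.isPSet _ (K.length_pos h)).act_mem _ (K.mem_words h) _ h).2

theorem act_singleton {x γ} (h : K.dom [x] γ) : K.act [x] γ = [K.letter x γ] := by
  have := K.length_act h
  obtain ⟨y, hy⟩ := List.length_eq_one_iff.1 this
  simp [letter, hy]

theorem head_dom {x η γ} (h : K.dom (x :: η) γ) :
    K.dom [x] γ ∧ K.act [x] γ = (K.act (x :: η) γ).take 1 := by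
  induction η using List.reverseRecOn with
  | nil =>
    refine ⟨h, (List.take_of_length_le ?_).symm⟩
    rw [K.length_act h]; rfl
  | append_singleton η y ih =>
    have h1 := (K.init_map (η.length + 1) (by simp)).2 _
      ⟨K.dom_mem h, by simp⟩ _ h
    have e : (x :: (η ++ [y])).dropLast = x :: η := by
      rw [← List.cons_append, List.dropLast_concat]
    rw [e] at h1
    obtain ⟨h2, h3⟩ := ih h1.1
    refine ⟨h2, ?_⟩
    rw [h3, h1.2, List.dropLast_eq_take, List.take_take, K.length_act h]
    simp

theorem tail_dom {x η γ} (h : K.dom (x :: η) γ) (hη : η ≠ []) :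
    K.dom η γ ∧ K.act η γ = (K.act (x :: η) γ).tail :=
  (K.tail_map η.length (List.length_pos_iff.2 hη)).2 _ ⟨K.dom_mem h, by simp⟩ _ h

theorem dom_all {η γ} (h : K.dom η γ) : ∀ x ∈ η, K.dom [x] γ := by
  induction η with
  | nil => simp
  | cons y η ih =>
    intro x hx
    rcases List.mem_cons.1 hx with rfl | hx
    · exact (K.head_dom h).1
    · exact ih (K.tail_dom h (List.ne_nil_of_mem hx)).1 x hx

theorem act_eq {η γ} (h : K.dom η γ) : K.act η γ = η.map (fun x => K.letter x γ) := by
  induction η with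
  | nil => exact absurd rfl (H.ne_nil (K.dom_mem h))
  | cons y η ih =>
    obtain ⟨h1, h2⟩ := K.head_dom h
    rw [K.act_singleton h1] at h2
    by_cases hη : η = []
    · subst hη; simpa using K.act_singleton h
    · obtain ⟨h3, h4⟩ := K.tail_dom h hη
      rw [ih h3] at h4
      rw [List.map_cons, h4]
      rw [← List.take_append_drop 1 (K.act (y :: η) γ), ← h2]
      simp

theorem nil_dom {η} (h : η ∈ H.dom) : K.dom η [] :=
  (K.isPSet _ (List.length_pos_iff.2 (H.ne_nil h))).nil_dom _ ⟨h, rfl⟩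

theorem letter_nil (x : H.carrier) : K.letter x [] = x := by
  have := (K.isPSet 1 one_pos).nil_act _ (mem_one x)
  simp [letter, this]

theorem letter_dom {x γ δ} (h : K.dom [x] (γ ++ δ)) : K.dom [K.letter x γ] δ := by
  have h0 : K.dom [x] γ := by
    induction δ using List.reverseRecOn with
    | nil => simpa using h
    | append_singleton δ a ih =>
      exact ih ((K.isPSet 1 one_pos).init_dom _ (mem_one x) (γ ++ δ) a (by simpa using h))
  have := (K.isPSet 1 one_pos).act_dom _ (mem_one x) _ _ h
  rwa [K.act_singleton h0] at this

theorem left_dom {η γ δ} (h : K.dom η (γ ++ δ)) : K.dom η γ := by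
  induction δ using List.reverseRecOn with
  | nil => simpa using h
  | append_singleton δ a ih =>
    exact ih ((K.isPSet _ (K.length_pos h)).init_dom _ (K.mem_words h) (γ ++ δ) a
      (by simpa using h))

theorem letter_letter {x γ δ} (h : K.dom [x] (γ ++ δ)) :
    K.letter (K.letter x γ) δ = K.letter x (γ ++ δ) := by
  have := (K.isPSet 1 one_pos).act_act _ (mem_one x) _ _ h
  rw [K.act_singleton (K.left_dom h), K.act_singleton (K.letter_dom h), K.act_singleton h] at this
  simpa using this

theorem word_mem {η γ} (h : K.dom η γ) (hγ : γ ≠ []) : γ ∈ F.dom :=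
  (K.isPSet _ (K.length_pos h)).word_mem _ (K.mem_words h) _ h hγ

theorem act_dom {η γ δ} (h : K.dom η (γ ++ δ)) : K.dom (K.act η γ) δ :=
  (K.isPSet _ (K.length_pos h)).act_dom _ (K.mem_words h) _ _ h

theorem collapse_dom {η β γ δ} (hγ : γ ≠ []) (h : K.dom η (β ++ γ ++ δ)) :
    K.dom η (β ++ F.prod γ :: δ) :=
  (K.isPSet _ (K.length_pos h)).collapse_dom _ (K.mem_words h) _ _ _ hγ h

theorem letter_collapse {x β γ δ} (hγ : γ ≠ []) (h : K.dom [x] (β ++ γ ++ δ)) :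
    K.letter x (β ++ F.prod γ :: δ) = K.letter x (β ++ γ ++ δ) := by
  have := (K.isPSet 1 one_pos).collapse_act _ (mem_one x) _ _ _ hγ h
  simp only [letter, this]

theorem insert_one_dom {η γ δ} (h : K.dom η (γ ++ δ)) : K.dom η (γ ++ F.one :: δ) :=
  (K.isPSet _ (K.length_pos h)).insert_one _ (K.mem_words h) _ _ h

theorem append_inv_dom {η γ} (h : K.dom η γ) : K.dom η (γ ++ F.invWord γ) :=
  (K.isPSet _ (K.length_pos h)).append_inv _ (K.mem_words h) _ h

theorem letter_one (x : H.carrier) : K.letter x [F.one] = x := by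
  have := (K.isPSet 1 one_pos).act_one _ (mem_one x)
  simp [letter, this]

theorem letter_append_inv {x γ} (h : K.dom [x] γ) : K.letter x (γ ++ F.invWord γ) = x := by
  by_cases hγ : γ = []
  · subst hγ; simpa [invWord] using K.letter_nil x
  · have h1 := K.append_inv_dom h
    have := K.letter_collapse (β := []) (δ := []) (γ := γ ++ F.invWord γ) (by simp [hγ])
      (by simpa using h1)
    rw [F.prod_append_invWord γ (K.word_mem h hγ)] at this
    simp only [List.nil_append, List.append_nil, K.letter_one] at this
    exact this.symm

theorem letter_letter_inv {x γ} (h : K.dom [x] γ) :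
    K.letter (K.letter x γ) (F.invWord γ) = x := by
  rw [K.letter_letter (K.append_inv_dom h), K.letter_append_inv h]

theorem letter_dom_inv {x γ} (h : K.dom [x] γ) : K.dom [K.letter x γ] (F.invWord γ) :=
  K.letter_dom (K.append_inv_dom h)

theorem inv_pair_dom {η γ} (h : K.dom η γ) : K.dom (η ++ H.invWord η) γ :=
  ((K.append_inv_map _ (K.length_pos h)).2 _ (K.mem_words h) _ h).1

theorem inv_letter {x γ} (h : K.dom [x] γ) :
    K.dom [H.inv x] γ ∧ K.letter (H.inv x) γ = H.inv (K.letter x γ) := by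
  have h1 := (K.append_inv_map _ one_pos).2 _ (mem_one x) _ h
  obtain ⟨h2, h3⟩ := h1
  have h4 := K.dom_all h2 (H.inv x) (by simp [invWord])
  refine ⟨h4, ?_⟩
  rw [K.act_eq h2, K.act_singleton h] at h3
  simpa [invWord] using h3

theorem collapse_left {a b c γ} (hb : b ≠ []) (h : K.dom (a ++ b ++ c) γ) :
    K.dom (a ++ H.prod b :: c) γ ∧
      K.letter (H.prod b) γ = H.prod (b.map (fun x => K.letter x γ)) := by
  have h1 := (K.collapse_map a.length b.length c.length (List.length_pos_iff.2 hb)).2 _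
    ⟨K.dom_mem h, by simp; omega⟩ _ h
  have e : ∀ a' b' c' : List H.carrier, a'.length = a.length → b'.length = b.length →
      (a' ++ b' ++ c').take a.length ++
        H.prod (((a' ++ b' ++ c').drop a.length).take b.length) ::
          (a' ++ b' ++ c').drop (a.length + b.length) = a' ++ H.prod b' :: c' := by
    intro a' b' c' h1 h2
    rw [← h1, ← h2]
    simp
  simp only [e a b c rfl rfl] at h1
  refine ⟨h1.1, ?_⟩
  have h2 := h1.2
  rw [K.act_eq h, K.act_eq h1.1] at h2
  simp only [List.map_append, List.map_cons] at h2
  rw [e _ _ _ (by simp) (by simp)] at h2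
  simpa using h2

theorem insert_one_left {a b γ} (h : K.dom (a ++ b) γ) : K.dom (a ++ H.one :: b) γ := by
  have := ((K.insert_one_map _ (K.length_pos h) a.length (by simp)).2 _ (K.mem_words h) _ h).1
  simpa using this

theorem one_letter {γ} (h : γ ∈ F.dom) : K.letter H.one γ = H.one := by
  simp [letter, K.one_act γ h]

/-- The elements `γ ⋉ η` of the semidirect product `F ⋉ H`. -/
abbrev SD : Type (max u v) := {p : F.carrier × H.carrier // K.dom [p.2] [F.inv p.1]}

/-- The `F`-components `(γ₁, …, γₙ)` of a word `(γ₁ ⋉ η₁, …, γₙ ⋉ ηₙ)`. -/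
def fsts (α : List K.SD) : List F.carrier := α.map (fun a => a.1.1)

/-- The word `A(α) = (η₁ ◁ (γ₂, …, γₙ), η₂ ◁ (γ₃, …, γₙ), …, ηₙ)`
of a word `α = (γ₁ ⋉ η₁, …, γₙ ⋉ ηₙ)`. -/
def twist : List K.SD → List H.carrier
  | [] => []
  | a :: α => K.letter a.1.2 (K.fsts α) :: twist α

/-- The composable words `α = (γᵢ ⋉ ηᵢ)ᵢ` of `F ⋉ H`: each `ηᵢ ◁ (γᵢ₊₁, …, γₙ)` is defined, and
`(A(α) | γₙ⁻¹, …, γ₁⁻¹)` belongs to the domain of the action. -/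
def sdDom : Set (List K.SD) :=
  {α | (∀ β a δ, α = β ++ a :: δ → K.dom [a.1.2] (K.fsts δ)) ∧
    K.dom (K.twist α) (F.invWord (K.fsts α))}

theorem prod_dom {ξ γ} (h : K.dom ξ (F.invWord γ)) (hγ : γ ≠ []) :
    K.dom [H.prod ξ] [F.inv (F.prod γ)] := by
  have hi := F.invWord_ne_nil hγ
  have hm := F.invWord_mem (K.word_mem h hi)
  rw [F.invWord_invWord] at hm
  rw [← F.prod_invWord γ hm]
  have h1 := (K.collapse_left (a := []) (c := []) (H.ne_nil (K.dom_mem h))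
    (by simpa using h)).1
  exact K.collapse_dom (β := []) (δ := []) hi (by simpa using h1)

/-- The unit `1 ⋉ 1`. -/
def sdOne : K.SD :=
  ⟨(F.one, H.one), K.one_dom _ (F.singleton_mem _)⟩

theorem ne_nil_of_mem {α} (h : α ∈ K.sdDom) : α ≠ [] := by
  rintro rfl
  exact H.ne_nil (K.dom_mem h.2) rfl

open Classical in
/-- The product `∇(γ₁, …, γₙ) ⋉ ∇(A(α))`. -/
noncomputable def sdProd (α : List K.SD) : K.SD :=
  if h : α ∈ K.sdDom then
    ⟨(F.prod (K.fsts α), H.prod (K.twist α)),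
      K.prod_dom h.2 (by simpa [fsts] using K.ne_nil_of_mem h)⟩
  else K.sdOne

/-- The inverse `γ⁻¹ ⋉ (η⁻¹ ◁ γ⁻¹)`. -/
def sdInv (a : K.SD) : K.SD :=
  ⟨(F.inv a.1.1, K.letter (H.inv a.1.2) [F.inv a.1.1]),
    K.letter_dom_inv (K.inv_letter a.2).1⟩

/-- The second components of the word with `A(α) = ξ` and `F`-components `γ`. -/
def untwist : List H.carrier → List F.carrier → List H.carrier
  | x :: ξ, _ :: γ => K.letter x (F.invWord γ) :: untwist ξ γ
  | _, _ => []

/-- The `H`-components of a word. -/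
def snds (α : List K.SD) : List H.carrier := α.map (fun a => a.1.2)

theorem length_twist (α : List K.SD) : (K.twist α).length = α.length := by
  induction α with
  | nil => rfl
  | cons a α ih => simp [twist, ih]

theorem untwist_twist (α : List K.SD)
    (h : ∀ β a δ, α = β ++ a :: δ → K.dom [a.1.2] (K.fsts δ)) :
    K.untwist (K.twist α) (K.fsts α) = K.snds α := by
  induction α with
  | nil => rfl
  | cons a α ih =>
    have h1 := h [] a α rfl
    have h2 := ih (fun β b δ e => h (a :: β) b δ (by simp [e]))
    simp only [fsts, snds, List.map_cons, twist, untwist] at h1 h2 ⊢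
    rw [h2, K.letter_letter_inv h1]

theorem twist_untwist (α : List K.SD) (ξ : List H.carrier) (hl : ξ.length = α.length)
    (hd : ∀ x ∈ ξ, K.dom [x] (F.invWord (K.fsts α)))
    (he : K.snds α = K.untwist ξ (K.fsts α)) :
    (∀ β a δ, α = β ++ a :: δ → K.dom [a.1.2] (K.fsts δ)) ∧ K.twist α = ξ := by
  induction α generalizing ξ with
  | nil =>
    refine ⟨fun β a δ e => by simp at e, ?_⟩
    simpa [twist, eq_comm] using hl
  | cons a α ih =>
    obtain ⟨x, ξ, rfl⟩ : ∃ x ξ', ξ = x :: ξ' := by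
      cases ξ with
      | nil => simp at hl
      | cons x ξ => exact ⟨x, ξ, rfl⟩
    have hf : F.invWord (K.fsts (a :: α)) = F.invWord (K.fsts α) ++ [F.inv a.1.1] := by
      simp [invWord, fsts]
    rw [hf] at hd
    have he1 : a.1.2 = K.letter x (F.invWord (K.fsts α)) ∧
        K.snds α = K.untwist ξ (K.fsts α) := by
      simpa [fsts, snds, untwist] using he
    obtain ⟨h1, h2⟩ := ih ξ (by simpa using hl)
      (fun y hy => K.left_dom (hd y (by simp [hy]))) he1.2
    have hx := K.left_dom (hd x (by simp))
    have h3 := K.letter_dom_inv hx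
    have h4 := K.letter_letter_inv hx
    rw [F.invWord_invWord, ← he1.1] at h3 h4
    constructor
    · intro β b δ e
      cases β with
      | nil =>
        simp only [List.nil_append, List.cons.injEq] at e
        obtain ⟨rfl, rfl⟩ := e
        exact h3
      | cons c β =>
        simp only [List.cons_append, List.cons.injEq] at e
        exact h1 β b δ e.2
    · simp [twist, h2, h4]

theorem mem_sdDom {α ξ} (hl : ξ.length = α.length) (hd : K.dom ξ (F.invWord (K.fsts α)))
    (he : K.snds α = K.untwist ξ (K.fsts α)) : α ∈ K.sdDom ∧ K.twist α = ξ := by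
  obtain ⟨h1, h2⟩ := K.twist_untwist α ξ hl (K.dom_all hd) he
  exact ⟨⟨h1, by rwa [h2]⟩, h2⟩

theorem snds_eq {α} (h : α ∈ K.sdDom) :
    K.snds α = K.untwist (K.twist α) (K.fsts α) := (K.untwist_twist α h.1).symm

theorem untwist_append (ξ ξ' : List H.carrier) (γ γ' : List F.carrier)
    (hl : ξ.length = γ.length)
    (hd : ∀ x ∈ ξ, K.dom [x] (F.invWord (γ ++ γ'))) :
    K.untwist (ξ ++ ξ') (γ ++ γ') =
      K.untwist (ξ.map (fun x => K.letter x (F.invWord γ'))) γ ++ K.untwist ξ' γ' := by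
  induction ξ generalizing γ with
  | nil =>
    obtain rfl : γ = [] := by simpa [eq_comm] using hl
    simp [untwist]
  | cons x ξ ih =>
    cases γ with
    | nil => simp at hl
    | cons g γ =>
      have hf : F.invWord (g :: γ ++ γ') = F.invWord γ' ++ F.invWord γ ++ [F.inv g] := by
        simp [invWord]
      rw [hf] at hd
      have := ih γ (by simpa using hl) (fun y hy => by
        rw [F.invWord_append]; exact K.left_dom (hd y (by simp [hy])))
      simp only [List.cons_append, untwist, List.map_cons, this]
      rw [F.invWord_append, ← K.letter_letter (K.left_dom (hd x (by simp)))]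

theorem fsts_append (α β : List K.SD) : K.fsts (α ++ β) = K.fsts α ++ K.fsts β := by
  simp [fsts]

theorem snds_append (α β : List K.SD) : K.snds (α ++ β) = K.snds α ++ K.snds β := by
  simp [snds]

theorem length_fsts (α : List K.SD) : (K.fsts α).length = α.length := by simp [fsts]

theorem length_snds (α : List K.SD) : (K.snds α).length = α.length := by simp [snds]

theorem fsts_mem {α} (h : α ∈ K.sdDom) : K.fsts α ∈ F.dom := by
  have hn : K.fsts α ≠ [] := by simpa [fsts] using K.ne_nil_of_mem h
  have := F.invWord_mem (K.word_mem h.2 (F.invWord_ne_nil hn))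
  rwa [F.invWord_invWord] at this

theorem sdProd_val {α} (h : α ∈ K.sdDom) :
    (K.sdProd α).1 = (F.prod (K.fsts α), H.prod (K.twist α)) := by
  rw [sdProd, dif_pos h]

theorem right_left_dom {a b γ} (hb : b ≠ []) (h : K.dom (a ++ b) γ) : K.dom b γ := by
  induction a with
  | nil => simpa using h
  | cons x a ih => exact ih (K.tail_dom h (by simp [hb])).1

theorem left_left_dom {a b γ} (ha : a ≠ []) (h : K.dom (a ++ b) γ) : K.dom a γ := by
  induction b using List.reverseRecOn with
  | nil => simpa using h
  | append_singleton b x ih =>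
    apply ih
    have h1 := (K.init_map (a ++ b).length (List.length_pos_iff.2 (by simp [ha]))).2 _
      ⟨K.dom_mem h, by simp; omega⟩ _ h
    have e : (a ++ (b ++ [x])).dropLast = a ++ b := by
      rw [← List.append_assoc, List.dropLast_concat]
    rw [e] at h1
    exact h1.1

/-- The description of the word `A` of a concatenation. -/
theorem twist_append (α β : List K.SD)
    (h : ∀ β' a δ, α ++ β = β' ++ a :: δ → K.dom [a.1.2] (K.fsts δ)) :
    K.twist (α ++ β) = (K.twist α).map (fun x => K.letter x (K.fsts β)) ++ K.twist β := by
  induction α with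
  | nil => rfl
  | cons a α ih =>
    have h1 := h [] a (α ++ β) rfl
    rw [fsts_append] at h1
    simp only [List.cons_append, twist, List.map_cons]
    rw [ih (fun β' b δ e => h (a :: β') b δ (by simp [e])), fsts_append, K.letter_letter h1]

theorem sd_right {α β} (hβ : β ≠ []) (h : α ++ β ∈ K.sdDom) :
    β ∈ K.sdDom ∧ K.dom (K.twist β) (F.invWord (K.fsts β) ++ F.invWord (K.fsts α)) := by
  have h2 := h.2
  rw [K.twist_append α β h.1, fsts_append, F.invWord_append] at h2
  have h3 := K.right_left_dom (by
    intro h0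
    have := K.length_twist β
    rw [h0] at this
    exact hβ (List.length_eq_zero_iff.1 this.symm)) h2
  exact ⟨⟨fun β' a δ e => h.1 (α ++ β') a δ (by simp [e]), K.left_dom h3⟩, h3⟩

theorem primed_left {α β : List K.SD}
    (h : ∀ β' a δ, α ++ β = β' ++ a :: δ → K.dom [a.1.2] (K.fsts δ)) :
    ∀ β' a δ, α = β' ++ a :: δ → K.dom [a.1.2] (K.fsts δ) := fun β' a δ e => by
  have := h β' a (δ ++ β) (by simp [e])
  rw [fsts_append] at this
  exact K.left_dom this

theorem twist_left {α β : List K.SD}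
    (h : ∀ β' a δ, α ++ β = β' ++ a :: δ → K.dom [a.1.2] (K.fsts δ)) :
    ∀ x ∈ K.twist α, K.dom [x] (K.fsts β) := by
  induction α with
  | nil => simp [twist]
  | cons a α ih =>
    intro x hx
    simp only [twist, List.mem_cons] at hx
    rcases hx with rfl | hx
    · have h1 := h [] a (α ++ β) rfl
      rw [fsts_append] at h1
      exact K.letter_dom h1
    · exact ih (fun β' b δ e => h (a :: β') b δ (by simp [e])) x hx

theorem sd_left {α β} (hα : α ≠ []) (h : α ++ β ∈ K.sdDom) : α ∈ K.sdDom := by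
  refine ⟨K.primed_left h.1, ?_⟩
  have h2 := h.2
  rw [K.twist_append α β h.1, fsts_append, F.invWord_append] at h2
  have h3 := K.left_left_dom (by
    intro h0
    have := K.length_twist α
    rw [List.map_eq_nil_iff.1 h0] at this
    exact hα (List.length_eq_zero_iff.1 this.symm)) h2
  have h4 := K.act_dom h3
  rw [K.act_eq (K.left_dom h3), List.map_map] at h4
  have e : (K.twist α).map ((fun x => K.letter x (F.invWord (K.fsts β))) ∘
      fun x => K.letter x (K.fsts β)) = (K.twist α).map id :=
    List.map_congr_left fun x hx => K.letter_letter_inv (K.twist_left h.1 x hx)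
  rwa [e, List.map_id] at h4

theorem twist_ne_nil {α : List K.SD} (h : α ≠ []) : K.twist α ≠ [] := by
  intro h0
  have := K.length_twist α
  rw [h0] at this
  exact h (List.length_eq_zero_iff.1 this.symm)

theorem sd_collapse (α β δ : List K.SD) (hβ : β ≠ []) (h : α ++ β ++ δ ∈ K.sdDom) :
    α ++ K.sdProd β :: δ ∈ K.sdDom ∧
      K.sdProd (α ++ K.sdProd β :: δ) = K.sdProd (α ++ β ++ δ) := by
  have hb := (K.sd_right hβ (K.sd_left (by simp [hβ]) h)).1
  have hv := K.sdProd_val hb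
  have hfn : K.fsts β ≠ [] := by simpa [fsts] using hβ
  have hin := F.invWord_ne_nil hfn
  have hbm := K.fsts_mem hb
  have hp1 : ∀ β' a δ', β ++ δ = β' ++ a :: δ' → K.dom [a.1.2] (K.fsts δ') :=
    fun β' a δ' e => h.1 (α ++ β') a δ' (by simp [e])
  have hp2 : ∀ β' a δ', α ++ (β ++ δ) = β' ++ a :: δ' → K.dom [a.1.2] (K.fsts δ') := by
    simpa using h.1
  have hta := K.twist_left hp2
  have htb := K.twist_left hp1
  have ht := K.twist_append α (β ++ δ) hp2
  rw [K.twist_append β δ hp1] at ht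
  have hd := h.2
  rw [List.append_assoc, ht, ← List.append_assoc] at hd
  set A := (K.twist α).map (fun x => K.letter x (K.fsts (β ++ δ))) with hA
  set B := (K.twist β).map (fun x => K.letter x (K.fsts δ)) with hB
  have hBn : B ≠ [] := by simpa [hB] using K.twist_ne_nil hβ
  rw [fsts_append, fsts_append, F.invWord_append, F.invWord_append] at hd
  have hd1 := (K.collapse_left hBn hd).1
  have hd0 : K.dom (A ++ B ++ K.twist δ) (F.invWord (K.fsts δ)) := by
    have hd' := hd
    rw [List.append_assoc (F.invWord (K.fsts δ))] at hd'
    exact K.left_dom hd'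
  have hd2 := (K.collapse_left hBn hd0).2
  have hd3 : K.dom (A ++ H.prod B :: K.twist δ) (F.invWord (K.fsts δ) ++
      F.inv (F.prod (K.fsts β)) :: F.invWord (K.fsts α)) := by
    rw [← F.prod_invWord _ hbm]
    exact K.collapse_dom hin (by simpa using hd1)
  have hf : K.fsts (α ++ K.sdProd β :: δ) =
      K.fsts α ++ F.prod (K.fsts β) :: K.fsts δ := by simp [fsts, hv]
  have hfi : F.invWord (K.fsts (α ++ K.sdProd β :: δ)) =
      F.invWord (K.fsts δ) ++ F.inv (F.prod (K.fsts β)) :: F.invWord (K.fsts α) := by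
    rw [hf]; simp [invWord]
  have key := K.mem_sdDom (α := α ++ K.sdProd β :: δ) (ξ := A ++ H.prod B :: K.twist δ)
    (by simp [hA, K.length_twist]) (by rw [hfi]; exact hd3) (by
      rw [hf, K.untwist_append A _ (K.fsts α) _ (by simp [hA, K.length_twist, K.length_fsts])
        (by
          intro x hx
          rw [← hf, hfi]
          exact K.dom_all hd3 x (by simp [hx]))]
      rw [snds_append]
      congr 1
      · rw [← K.untwist_twist α (K.primed_left hp2)]
        congr 1
        rw [hA, List.map_map]
        conv_lhs => rw [← List.map_id (K.twist α)]
        apply List.map_congr_left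
        intro x hx
        have hx1 := hta x hx
        have hy : K.letter x (K.fsts (β ++ δ)) ∈ A := by
          rw [hA]; exact List.mem_map.2 ⟨x, hx, rfl⟩
        have h4 := K.dom_all hd _ (by
          simp only [List.mem_append]; exact Or.inl (Or.inl hy))
        have h5 := K.letter_collapse (β := F.invWord (K.fsts δ))
          (γ := F.invWord (K.fsts β)) (δ := []) hin (by simpa using K.left_dom h4)
        rw [F.prod_invWord _ hbm] at h5
        have h6 : F.invWord (F.prod (K.fsts β) :: K.fsts δ) =
            F.invWord (K.fsts δ) ++ [F.inv (F.prod (K.fsts β))] := by simp [invWord]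
        simp only [Function.comp_apply, id]
        rw [h6, h5, List.append_nil, ← F.invWord_append, ← fsts_append,
          K.letter_letter_inv hx1]
      · simp only [snds, List.map_cons, untwist]
        rw [hd2, hv, hB, List.map_map]
        have e : (K.twist β).map ((fun x => K.letter x (F.invWord (K.fsts δ))) ∘
            fun x => K.letter x (K.fsts δ)) = (K.twist β).map id :=
          List.map_congr_left fun x hx => K.letter_letter_inv (htb x hx)
        rw [e, List.map_id]
        congr 1
        exact (K.untwist_twist δ (fun β' a δ' e => hp1 (β ++ β') a δ' (by simp [e]))).symm)
  refine ⟨key.1, Subtype.ext ?_⟩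
  rw [K.sdProd_val key.1, K.sdProd_val h, key.2, hf]
  have e1 := F.collapse_prod (K.fsts α) (K.fsts β) (K.fsts δ) hfn
    (by simpa [fsts_append] using K.fsts_mem h)
  have e2 := H.collapse_prod A B (K.twist δ) hBn (K.dom_mem hd)
  rw [e1, e2, List.append_assoc α, ht, fsts_append, fsts_append]
  simp

theorem sd_singleton (a : K.SD) : [a] ∈ K.sdDom ∧ K.twist [a] = [a.1.2] := by
  refine K.mem_sdDom rfl ?_ ?_
  · simpa [fsts, invWord] using a.2
  · simp [snds, untwist, fsts, invWord, K.letter_nil]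

theorem sdInv_sdInv (a : K.SD) : K.sdInv (K.sdInv a) = a := by
  have h0 := a.2
  have h1 := K.inv_letter h0
  have h2 : K.dom [H.inv a.1.2] ([F.inv a.1.1] ++ F.invWord [F.inv a.1.1]) :=
    K.append_inv_dom h1.1
  have h3 := K.inv_letter (K.letter_dom h2)
  have h4 := K.letter_letter_inv h1.1
  have h5 : F.invWord [F.inv a.1.1] = [F.inv (F.inv a.1.1)] := by simp [invWord]
  rw [h5] at h3 h4
  apply Subtype.ext
  apply Prod.ext
  · exact F.inv_inv _
  · change K.letter (H.inv (K.letter (H.inv a.1.2) [F.inv a.1.1])) [F.inv (F.inv a.1.1)] = _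
    rw [h3.2, h4, H.inv_inv]

/-- The inverse of a word of the semidirect product, componentwise. -/
theorem untwist_inv (α : List K.SD) (ξ : List H.carrier) (hl : ξ.length = α.length)
    (hd : ∀ x ∈ ξ, K.dom [x] (F.invWord (K.fsts α)))
    (he : K.snds α = K.untwist ξ (K.fsts α)) :
    K.untwist ((H.invWord ξ).map (fun x => K.letter x (F.invWord (K.fsts α))))
      (F.invWord (K.fsts α)) = K.snds (α.map K.sdInv).reverse := by
  induction α generalizing ξ with
  | nil =>
    obtain rfl : ξ = [] := by simpa using hl
    rfl
  | cons a α ih =>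
    obtain ⟨x, ξ, rfl⟩ : ∃ x ξ', ξ = x :: ξ' := by
      cases ξ with
      | nil => simp at hl
      | cons x ξ => exact ⟨x, ξ, rfl⟩
    have hf : F.invWord (K.fsts (a :: α)) = F.invWord (K.fsts α) ++ [F.inv a.1.1] := by
      simp [invWord, fsts]
    rw [hf] at hd
    have he1 : a.1.2 = K.letter x (F.invWord (K.fsts α)) ∧
        K.snds α = K.untwist ξ (K.fsts α) := by
      simpa [fsts, snds, untwist] using he
    have h1 := ih ξ (by simpa using hl)
      (fun y hy => K.left_dom (hd y (by simp [hy]))) he1.2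
    have hinv : H.invWord (x :: ξ) = H.invWord ξ ++ [H.inv x] := by simp [invWord]
    have hg : F.invWord [F.inv a.1.1] = [F.inv (F.inv a.1.1)] := by simp [invWord]
    have hdi : ∀ y ∈ H.invWord ξ, K.dom [y] (F.invWord (K.fsts α) ++ [F.inv a.1.1]) := by
      intro y hy
      simp only [invWord, List.mem_reverse, List.mem_map] at hy
      obtain ⟨z, hz, rfl⟩ := hy
      exact (K.inv_letter (hd z (by simp [hz]))).1
    have hx := K.inv_letter (hd x (by simp))
    have hx2 := K.inv_letter (K.left_dom (hd x (by simp)))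
    have hlx : ξ.length = α.length := by simpa using hl
    rw [hf, hinv, List.map_append, K.untwist_append]
    · have e : ((a :: α).map K.sdInv).reverse = (α.map K.sdInv).reverse ++ [K.sdInv a] := by
        simp
      rw [e, snds_append, ← h1]
      congr 1
      · congr 1
        rw [List.map_map, hg]
        apply List.map_congr_left
        intro y hy
        have h2 := hdi y hy
        have h3 := K.append_inv_dom h2
        rw [F.invWord_append, hg] at h3
        have h4 : K.dom [y] (F.invWord (K.fsts α) ++ [F.inv a.1.1, F.inv (F.inv a.1.1)] ++
            F.invWord (F.invWord (K.fsts α))) := by simpa using h3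
        have h5 := K.letter_letter (γ := F.invWord (K.fsts α) ++ [F.inv a.1.1])
          (δ := [F.inv (F.inv a.1.1)]) (x := y) (K.left_dom (by simpa using h3))
        have h6 := K.letter_collapse (β := F.invWord (K.fsts α)) (δ := [])
          (γ := [F.inv a.1.1, F.inv (F.inv a.1.1)]) (x := y) (by simp)
          (K.left_dom (by simpa using h4))
        have h7 : K.letter y (F.invWord (K.fsts α) ++ [F.one]) =
            K.letter y (F.invWord (K.fsts α)) := by
          rw [← K.letter_letter (K.insert_one_dom (δ := [])
            (by simpa using K.left_dom h2)), K.letter_one]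
        simp only [Function.comp_apply]
        rw [h5]
        rw [F.prod_inv, h7] at h6
        simpa using h6.symm
      · simp only [List.map_cons, List.map_nil, untwist, snds, sdInv]
        have h2 := K.letter_letter hx.1
        rw [hx2.2, ← he1.1] at h2
        rw [h2]
        simp [invWord, K.letter_nil]
    · simp [invWord, length_fsts, hlx]
    · intro y hy
      obtain ⟨z, hz, rfl⟩ := List.mem_map.1 hy
      exact K.letter_dom_inv (hdi z hz)

theorem sd_append_inv (α : List K.SD) (h : α ∈ K.sdDom) :
    α ++ (α.map K.sdInv).reverse ∈ K.sdDom ∧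
      K.twist (α ++ (α.map K.sdInv).reverse) =
        (K.twist α ++ H.invWord (K.twist α)).map
          (fun x => K.letter x (F.invWord (K.fsts α))) := by
  have hfi : K.fsts (α.map K.sdInv).reverse = F.invWord (K.fsts α) := by
    simp [fsts, invWord, sdInv, Function.comp_def]
  have hf : K.fsts (α ++ (α.map K.sdInv).reverse) = K.fsts α ++ F.invWord (K.fsts α) := by
    rw [fsts_append, hfi]
  have h1 := K.inv_pair_dom h.2
  have h2 := K.append_inv_dom (K.append_inv_dom h1)
  rw [F.invWord_append, F.invWord_invWord, List.append_assoc] at h2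
  have h3 := K.act_dom h2
  rw [K.act_eq h1] at h3
  rw [← List.append_assoc] at h3
  have h4 := K.left_dom h3
  have hl := K.length_twist α
  refine K.mem_sdDom (by simp [invWord, hl]) ?_ ?_
  · rw [hf, F.invWord_append, F.invWord_invWord]
    exact h4
  · rw [hf, List.map_append, K.untwist_append, snds_append]
    · congr 1
      · rw [K.snds_eq h, List.map_map]
        congr 1
        conv_lhs => rw [← List.map_id (K.twist α)]
        apply List.map_congr_left
        intro x hx
        exact (K.letter_letter_inv (K.dom_all h.2 x hx)).symm
      · exact (K.untwist_inv α _ hl (K.dom_all h.2) (K.snds_eq h)).symm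
    · simp [hl, length_fsts]
    · intro x hx
      rw [F.invWord_append, F.invWord_invWord]
      exact K.dom_all h4 x (by rw [List.map_append]; exact List.mem_append_left _ hx)

theorem sd_insert_one (α β : List K.SD) (h : α ++ β ∈ K.sdDom) :
    α ++ K.sdOne :: β ∈ K.sdDom ∧
      K.twist (α ++ K.sdOne :: β) =
        (K.twist α).map (fun x => K.letter x (K.fsts β)) ++ H.one :: K.twist β := by
  have ht := K.twist_append α β h.1
  have hd := h.2
  rw [ht, fsts_append, F.invWord_append] at hd
  have hf : K.fsts (α ++ K.sdOne :: β) = K.fsts α ++ F.one :: K.fsts β := by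
    simp [fsts, sdOne]
  have hfi : F.invWord (K.fsts (α ++ K.sdOne :: β)) =
      F.invWord (K.fsts β) ++ F.one :: F.invWord (K.fsts α) := by
    rw [hf]; simp [invWord, F.inv_one]
  have h1 := K.insert_one_dom (K.insert_one_left hd)
  refine K.mem_sdDom (by simp [length_twist]) (by rw [hfi]; exact h1) ?_
  rw [hf, K.untwist_append _ _ _ _ (by simp [length_twist, length_fsts]), snds_append]
  · congr 1
    · rw [← K.untwist_twist α (K.primed_left h.1), List.map_map]
      congr 1
      conv_lhs => rw [← List.map_id (K.twist α)]
      apply List.map_congr_left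
      intro x hx
      have hx1 := K.twist_left h.1 x hx
      have h2 : F.invWord (F.one :: K.fsts β) = F.invWord (K.fsts β) ++ [F.one] := by
        simp [invWord, F.inv_one]
      simp only [Function.comp_apply, id]
      rw [h2, ← K.letter_letter (K.insert_one_dom (δ := [])
        (by simpa using K.letter_dom_inv hx1)), K.letter_one, K.letter_letter_inv hx1]
    · simp only [snds, List.map_cons, untwist]
      congr 1
      · by_cases hβ : K.fsts β = []
        · rw [hβ]; simpa [invWord, sdOne] using (K.letter_nil _).symm
        · rw [K.one_letter (K.word_mem (K.left_dom hd) (F.invWord_ne_nil hβ))]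
          rfl
      · by_cases hβ : β = []
        · subst hβ; rfl
        · exact K.snds_eq (K.sd_right hβ h).1
  · intro x hx
    rw [← hf, hfi]
    exact K.dom_all h1 x (List.mem_append_left _ hx)

/-- The semidirect product `F ⋉ H` of an `F`-partial group `H` by `F`. -/
@[reducible] noncomputable def semidirect : PartialGroup.{max u v} where
  carrier := K.SD
  dom := K.sdDom
  prod := K.sdProd
  one := K.sdOne
  inv := K.sdInv
  ne_nil := K.ne_nil_of_mem
  singleton_mem := fun a => (K.sd_singleton a).1
  prod_singleton := fun a => by
    apply Subtype.ext
    rw [K.sdProd_val (K.sd_singleton a).1, (K.sd_singleton a).2]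
    simp [fsts, F.prod_singleton, H.prod_singleton]
  tail_mem := fun a w hw h => (K.sd_right (α := [a]) hw h).1
  init_mem := fun w a hw h => K.sd_left hw h
  collapse_mem := fun a b c hb h => (K.sd_collapse a b c hb h).1
  collapse_prod := fun a b c hb h => (K.sd_collapse a b c hb h).2
  insert_one := fun a b h => (K.sd_insert_one a b h).1
  one_prod := fun a => by
    have h := K.sd_insert_one [] [a] (K.sd_singleton a).1
    apply Subtype.ext
    have h1 := K.sdProd_val h.1
    rw [h.2, (K.sd_singleton a).2] at h1
    simp only [List.nil_append, twist, List.map_nil] at h1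
    rw [h1]
    simp [fsts, sdOne, F.one_prod, H.one_prod]
  prod_one := fun a => by
    have h := K.sd_insert_one [a] [] (K.sd_singleton a).1
    apply Subtype.ext
    have h1 := K.sdProd_val h.1
    rw [h.2, (K.sd_singleton a).2] at h1
    simp only [List.singleton_append, twist, List.map_cons, List.map_nil] at h1
    rw [h1]
    simp [fsts, sdOne, F.prod_one, H.prod_one, K.letter_nil]
  append_inv := fun w h => (K.sd_append_inv w h).1
  inv_append := fun w h => by
    have h1 := (K.sd_append_inv w h).1
    have hn : (w.map K.sdInv).reverse ≠ [] := by simpa using K.ne_nil_of_mem h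
    have h2 := (K.sd_append_inv _ (K.sd_right hn h1).1).1
    have e : (((w.map K.sdInv).reverse).map K.sdInv).reverse = w := by
      simp [List.map_reverse, Function.comp_def, K.sdInv_sdInv]
    rwa [e] at h2
  prod_inv := fun a => by
    have h := K.sd_append_inv [a] (K.sd_singleton a).1
    have h1 := K.sdProd_val h.1
    rw [h.2, (K.sd_singleton a).2] at h1
    have h2 := K.inv_letter a.2
    have e : F.invWord (K.fsts [a]) = [F.inv a.1.1] := by simp [invWord, fsts]
    apply Subtype.ext
    simp only [e] at h1
    simp only [invWord, List.map_cons, List.map_nil, List.reverse_singleton,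
      List.singleton_append, h2.2, H.prod_inv] at h1
    rw [h1]
    simp [fsts, sdInv, F.prod_inv, sdOne]
  inv_prod := fun a => by
    have h := K.sd_append_inv [K.sdInv a] (K.sd_singleton _).1
    have h1 := K.sdProd_val h.1
    rw [h.2, (K.sd_singleton _).2] at h1
    have h2 := K.inv_letter (K.sdInv a).2
    have e : F.invWord (K.fsts [K.sdInv a]) = [F.inv (K.sdInv a).1.1] := by simp [invWord, fsts]
    apply Subtype.ext
    simp only [e] at h1
    simp only [invWord, List.map_cons, List.map_nil, List.reverse_singleton,
      List.singleton_append, h2.2, H.prod_inv, K.sdInv_sdInv] at h1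
    rw [h1]
    simp [fsts, sdInv, F.inv_prod, sdOne]

end Action
section wedge

open Classical in
/-- The element `[x, a]` of the wedge sum of copies of `G`: the pair `(x, a)` if `a ≠ 1`, and the
unit if `a = 1`. -/
noncomputable def bracket {Λ : Type u} {G : Type v} [Group G] (x : Λ) (a : G) :
    Option (Λ × {a : G // a ≠ 1}) :=
  if h : a = 1 then none else some (x, ⟨a, h⟩)

/-- The composable words of the wedge sum. -/
def wedgeDom (Λ : Type u) (G : Type v) [Group G] : Set (List (Option (Λ × {a : G // a ≠ 1}))) :=
  {w | w ≠ [] ∧ ∃ (x : Λ) (l : List G), w = l.map (bracket x)}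

open Classical in
/-- The product `∇([x, a₁], …, [x, aₙ]) = [x, a₁ ⋯ aₙ]` of the wedge sum. -/
noncomputable def wedgeProd {Λ : Type u} {G : Type v} [Group G]
    (w : List (Option (Λ × {a : G // a ≠ 1}))) : Option (Λ × {a : G // a ≠ 1}) :=
  if h : ∃ p : Λ × List G, w = p.2.map (bracket p.1) then
    bracket h.choose.1 h.choose.2.prod else none

variable {Λ : Type u} {G : Type v} [Group G]

@[simp] theorem bracket_one (x : Λ) : bracket x (1 : G) = none := by simp [bracket]

theorem bracket_eq {x y : Λ} {a b : G} (h : bracket x a = bracket y b) :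
    a = b ∧ (a = 1 ∨ x = y) := by
  unfold bracket at h
  split_ifs at h with h1 h2 h2 <;> simp_all

theorem exists_bracket [Nonempty Λ] (p : Option (Λ × {a : G // a ≠ 1})) :
    ∃ x a, p = bracket x a := by
  rcases p with _ | ⟨x, a, ha⟩
  · exact ⟨Classical.arbitrary Λ, 1, by simp⟩
  · exact ⟨x, a, by simp [bracket, ha]⟩

theorem bracket_words {x y : Λ} {l m : List G} (h : l.map (bracket x) = m.map (bracket y)) :
    l = m ∧ (l.prod = 1 ∨ x = y) := by
  induction l generalizing m with
  | nil =>
    have : m = [] := by simpa [eq_comm] using h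
    subst this; simp
  | cons a l ih =>
    cases m with
    | nil => simp at h
    | cons b m =>
      simp only [List.map_cons, List.cons.injEq] at h
      obtain ⟨rfl, h1⟩ := bracket_eq h.1
      obtain ⟨rfl, h2⟩ := ih h.2
      refine ⟨rfl, ?_⟩
      rcases h1 with rfl | rfl
      · simpa using h2
      · exact Or.inr rfl

theorem wedgeProd_map (x : Λ) (l : List G) :
    wedgeProd (l.map (bracket x)) = bracket x l.prod := by
  have h : ∃ p : Λ × List G, l.map (bracket x) = p.2.map (bracket p.1) := ⟨(x, l), rfl⟩
  rw [wedgeProd, dif_pos h]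
  obtain ⟨h1, h2⟩ := bracket_words h.choose_spec
  rw [← h1]
  rcases h2 with h2 | h2
  · rw [h2]; simp
  · rw [← h2]

/-- Inversion in the wedge sum. -/
def wedgeInv (p : Option (Λ × {a : G // a ≠ 1})) : Option (Λ × {a : G // a ≠ 1}) :=
  p.map (fun q => (q.1, ⟨q.2.1⁻¹, inv_ne_one.2 q.2.2⟩))

theorem wedgeInv_bracket (x : Λ) (a : G) : wedgeInv (bracket x a) = bracket x a⁻¹ := by
  by_cases h : a = 1 <;> simp [wedgeInv, bracket, h]

theorem wedgeInv_words (x : Λ) (l : List G) :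
    ((l.map (bracket x)).map wedgeInv).reverse = ((l.map (·⁻¹)).reverse).map (bracket x) := by
  simp [Function.comp_def, wedgeInv_bracket, List.map_reverse]

/-- The wedge sum of copies of the group `G` indexed by `Λ`. -/
@[reducible] noncomputable def wedge (Λ : Type u) (G : Type v) [Group G] (hΛ : Nonempty Λ) :
    PartialGroup.{max u v} where
  carrier := Option (Λ × {a : G // a ≠ 1})
  dom := wedgeDom Λ G
  prod := wedgeProd
  one := none
  inv := wedgeInv
  ne_nil := fun h => h.1
  singleton_mem := fun p => by
    obtain ⟨x, a, rfl⟩ := exists_bracket p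
    exact ⟨by simp, x, [a], rfl⟩
  prod_singleton := fun p => by
    obtain ⟨x, a, rfl⟩ := exists_bracket p
    simpa using wedgeProd_map x [a]
  tail_mem := by
    rintro p w hw ⟨-, x, l, h⟩
    obtain ⟨b, t, rfl, rfl, rfl⟩ := List.map_eq_cons_iff.1 h.symm
    exact ⟨hw, x, t, rfl⟩
  init_mem := by
    rintro w p hw ⟨-, x, l, h⟩
    obtain ⟨s, t, rfl, rfl, -⟩ := List.map_eq_append_iff.1 h.symm
    exact ⟨hw, x, s, rfl⟩
  collapse_mem := by
    rintro a b d hb ⟨-, x, l, h⟩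
    obtain ⟨t', s₃, rfl, h', rfl⟩ := List.map_eq_append_iff.1 h.symm
    obtain ⟨s₁, s₂, rfl, rfl, rfl⟩ := List.map_eq_append_iff.1 h'
    exact ⟨by simp, x, s₁ ++ s₂.prod :: s₃, by simp [wedgeProd_map]⟩
  collapse_prod := by
    rintro a b d hb ⟨-, x, l, h⟩
    obtain ⟨t', s₃, rfl, h', rfl⟩ := List.map_eq_append_iff.1 h.symm
    obtain ⟨s₁, s₂, rfl, rfl, rfl⟩ := List.map_eq_append_iff.1 h'
    have h1 := wedgeProd_map x (s₁ ++ s₂.prod :: s₃)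
    have h2 := wedgeProd_map x (s₁ ++ s₂ ++ s₃)
    simp only [List.map_append, List.map_cons] at h1 h2
    rw [wedgeProd_map, h1, h2]
    simp
  insert_one := by
    rintro a b ⟨-, x, l, h⟩
    obtain ⟨s₁, s₂, rfl, rfl, rfl⟩ := List.map_eq_append_iff.1 h.symm
    exact ⟨by simp, x, s₁ ++ 1 :: s₂, by simp⟩
  one_prod := fun p => by
    obtain ⟨x, a, rfl⟩ := exists_bracket p
    simpa using wedgeProd_map x [1, a]
  prod_one := fun p => by
    obtain ⟨x, a, rfl⟩ := exists_bracket p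
    simpa using wedgeProd_map x [a, 1]
  append_inv := by
    rintro w ⟨hw, x, l, rfl⟩
    refine ⟨by simp [hw], x, l ++ (l.map (·⁻¹)).reverse, ?_⟩
    rw [wedgeInv_words, List.map_append]
  inv_append := by
    rintro w ⟨hw, x, l, rfl⟩
    refine ⟨by simp [hw], x, (l.map (·⁻¹)).reverse ++ l, ?_⟩
    rw [wedgeInv_words, List.map_append]
  prod_inv := fun p => by
    obtain ⟨x, a, rfl⟩ := exists_bracket p
    rw [wedgeInv_bracket]
    simpa using wedgeProd_map x [a, a⁻¹]
  inv_prod := fun p => by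
    obtain ⟨x, a, rfl⟩ := exists_bracket p
    rw [wedgeInv_bracket]
    simpa using wedgeProd_map x [a⁻¹, a]

variable {F : PartialGroup.{w}}

/-- The composable pairs `([x, a₁], …, [x, aᵣ] | γ)` with `(x | γ)` composable. -/
def wedgeActDom (G : Type v) [Group G] (dom : Λ → List F.carrier → Prop)
    (η : List (Option (Λ × {a : G // a ≠ 1}))) (γ : List F.carrier) : Prop :=
  η ≠ [] ∧ ∃ (x : Λ) (l : List G), η = l.map (bracket x) ∧ dom x γ

/-- `([x, a₁], …, [x, aᵣ]) ◁ γ = ([x ◁ γ, a₁], …, [x ◁ γ, aᵣ])`. -/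
def wedgeAct (G : Type v) [Group G] (act : Λ → List F.carrier → Λ)
    (η : List (Option (Λ × {a : G // a ≠ 1}))) (γ : List F.carrier) :
    List (Option (Λ × {a : G // a ≠ 1})) :=
  η.map (Option.map (fun q => (act q.1 γ, q.2)))

theorem wedgeAct_map (act : Λ → List F.carrier → Λ) (x : Λ) (l : List G) (γ : List F.carrier) :
    wedgeAct G act (l.map (bracket x)) γ = l.map (bracket (act x γ)) := by
  rw [wedgeAct, List.map_map]
  apply List.map_congr_left
  intro a _
  by_cases h : a = 1 <;> simp [bracket, h]

theorem wedge_invWord (hΛ : Nonempty Λ) (x : Λ) (l : List G) :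
    (wedge Λ G hΛ).invWord (l.map (bracket x)) = ((l.map (·⁻¹)).reverse).map (bracket x) :=
  wedgeInv_words x l

/-- For a friendly `F`-set `Λ` and a group `G`, the wedge sum of copies of `G` indexed by `Λ` is
an `F`-partial group. -/
noncomputable def wedgeAction (G : Type v) [Group G] {dom : Λ → List F.carrier → Prop}
    {act : Λ → List F.carrier → Λ} (hΛ : Nonempty Λ)
    (h : IsPSet F (Set.univ : Set Λ) dom act)
    (hf : Friendly F (Set.univ : Set Λ) dom) : Action F (wedge Λ G hΛ) where
  dom := wedgeActDom G dom
  act := wedgeAct G act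
  dom_mem := by
    rintro η γ ⟨h1, x, l, rfl, -⟩
    exact ⟨h1, x, l, rfl⟩
  isPSet := fun r hr =>
    { nonempty := ⟨(List.replicate r 1).map (bracket (Classical.choice hΛ)),
        ⟨by simp; omega, _, _, rfl⟩, by simp⟩
      word_mem := by
        rintro η - γ ⟨-, x, l, -, h1⟩ h2
        exact h.word_mem x trivial γ h1 h2
      act_mem := by
        rintro η h2 γ ⟨h3, x, l, rfl, h1⟩
        rw [wedgeAct_map]
        exact ⟨⟨by simpa using h3, _, _, rfl⟩, by simpa using h2.2⟩
      nil_dom := by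
        rintro η ⟨⟨h1, x, l, rfl⟩, h2⟩
        exact ⟨h1, x, l, rfl, h.nil_dom x trivial⟩
      nil_act := by
        rintro η ⟨⟨h1, x, l, rfl⟩, h2⟩
        rw [wedgeAct_map, h.nil_act x trivial]
      init_dom := by
        rintro η - γ a ⟨h3, x, l, rfl, h1⟩
        exact ⟨h3, x, l, rfl, h.init_dom x trivial _ _ h1⟩
      act_dom := by
        rintro η - γ δ ⟨h3, x, l, rfl, h1⟩
        rw [wedgeAct_map]
        exact ⟨by simpa using h3, _, l, rfl, h.act_dom x trivial _ _ h1⟩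
      act_act := by
        rintro η - γ δ ⟨h3, x, l, rfl, h1⟩
        rw [wedgeAct_map, wedgeAct_map, wedgeAct_map, h.act_act x trivial _ _ h1]
      collapse_dom := by
        rintro η - β γ δ hγ ⟨h3, x, l, rfl, h1⟩
        exact ⟨h3, x, l, rfl, h.collapse_dom x trivial _ _ _ hγ h1⟩
      collapse_act := by
        rintro η - β γ δ hγ ⟨h3, x, l, rfl, h1⟩
        rw [wedgeAct_map, wedgeAct_map, h.collapse_act x trivial _ _ _ hγ h1]
      insert_one := by
        rintro η - γ δ ⟨h3, x, l, rfl, h1⟩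
        exact ⟨h3, x, l, rfl, h.insert_one x trivial _ _ h1⟩
      act_one := by
        rintro η ⟨⟨h1, x, l, rfl⟩, h2⟩
        rw [wedgeAct_map, h.act_one x trivial]
      append_inv := by
        rintro η - γ ⟨h3, x, l, rfl, h1⟩
        exact ⟨h3, x, l, rfl, h.append_inv x trivial _ h1⟩ }
  tail_map := fun r hr => by
    constructor
    · rintro η ⟨⟨h1, x, l, rfl⟩, h2⟩
      have h3 : l.length = r + 1 := by simpa using h2
      refine ⟨⟨?_, x, l.tail, by simp⟩, by simp [h3]⟩
      rw [← List.length_pos_iff]; simp [h3, hr]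
    · rintro η ⟨-, h2⟩ γ ⟨h3, x, l, rfl, h1⟩
      have h3 : l.length = r + 1 := by simpa using h2
      refine ⟨⟨?_, x, l.tail, by simp, h1⟩, ?_⟩
      · rw [← List.length_pos_iff]; simp [h3, hr]
      · rw [← List.map_tail, wedgeAct_map, wedgeAct_map, List.map_tail]
  init_map := fun r hr => by
    constructor
    · rintro η ⟨⟨h1, x, l, rfl⟩, h2⟩
      have h3 : l.length = r + 1 := by simpa using h2
      refine ⟨⟨?_, x, l.dropLast, by simp⟩, by simp [h3]⟩
      rw [← List.length_pos_iff]; simp [h3, hr]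
    · rintro η ⟨-, h2⟩ γ ⟨h3, x, l, rfl, h1⟩
      have h3 : l.length = r + 1 := by simpa using h2
      refine ⟨⟨?_, x, l.dropLast, by simp, h1⟩, ?_⟩
      · rw [← List.length_pos_iff]; simp [h3, hr]
      · rw [← List.map_dropLast, wedgeAct_map, wedgeAct_map, List.map_dropLast]
  collapse_map := fun p q r hq => by
    have key : ∀ (x : Λ) (l : List G),
        (l.map (bracket x)).take p ++ (wedge Λ G hΛ).prod (((l.map (bracket x)).drop p).take q) ::
          (l.map (bracket x)).drop (p + q) =
        (l.take p ++ ((l.drop p).take q).prod :: l.drop (p + q)).map (bracket x) := by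
      intro x l
      have := wedgeProd_map x ((l.drop p).take q)
      simp only [List.map_append, List.map_cons, List.map_take, List.map_drop] at this ⊢
      rw [← this]
    constructor
    · rintro η ⟨⟨h1, x, l, rfl⟩, h2⟩
      have h3 : l.length = p + q + r := by simpa using h2
      simp only [key]
      exact ⟨⟨by simp, x, _, rfl⟩, by simp [h3]; omega⟩
    · rintro η ⟨-, h2⟩ γ ⟨h3, x, l, rfl, h1⟩
      simp only [wedgeAct_map, key]
      exact ⟨⟨by simp, x, _, rfl, h1⟩, trivial⟩
  insert_one_map := fun r hr i hi => by
    have key : ∀ (x : Λ) (l : List G),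
        (l.map (bracket x)).take i ++ (wedge Λ G hΛ).one :: (l.map (bracket x)).drop i =
        (l.take i ++ 1 :: l.drop i).map (bracket x) := by
      intro x l
      simp only [List.map_append, List.map_cons, List.map_take, List.map_drop, bracket_one]
    constructor
    · rintro η ⟨⟨h1, x, l, rfl⟩, h2⟩
      have h3 : l.length = r := by simpa using h2
      simp only [key]
      exact ⟨⟨by simp, x, _, rfl⟩, by simp [h3]; omega⟩
    · rintro η ⟨-, h2⟩ γ ⟨h3, x, l, rfl, h1⟩
      simp only [wedgeAct_map, key]
      exact ⟨⟨by simp, x, _, rfl, h1⟩, trivial⟩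
  one_dom := fun γ hγ => by
    obtain ⟨x, -, hx⟩ := hf γ hγ
    refine ⟨by simp, x, [1], ?_, hx⟩
    simp [wedge]
  one_act := fun γ hγ => rfl
  append_inv_map := fun r hr => by
    have key : ∀ (x : Λ) (l : List G), l.map (bracket x) ++ (wedge Λ G hΛ).invWord (l.map (bracket x)) =
        (l ++ (l.map (·⁻¹)).reverse).map (bracket x) := by
      intro x l
      rw [List.map_append, ← wedge_invWord hΛ]
    constructor
    · rintro η ⟨⟨h1, x, l, rfl⟩, h2⟩
      have h3 : l.length = r := by simpa using h2
      simp only [key]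
      exact ⟨⟨by simpa using h1, x, _, rfl⟩, by simp [h3]; omega⟩
    · rintro η ⟨-, h2⟩ γ ⟨h3, x, l, rfl, h1⟩
      simp only [wedgeAct_map, key]
      exact ⟨⟨by simpa using h3, x, _, rfl, h1⟩, trivial⟩
  inv_append_map := fun r hr => by
    have key : ∀ (x : Λ) (l : List G), (wedge Λ G hΛ).invWord (l.map (bracket x)) ++ l.map (bracket x) =
        ((l.map (·⁻¹)).reverse ++ l).map (bracket x) := by
      intro x l
      rw [List.map_append, ← wedge_invWord hΛ]
    constructor
    · rintro η ⟨⟨h1, x, l, rfl⟩, h2⟩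
      have h3 : l.length = r := by simpa using h2
      simp only [key]
      exact ⟨⟨by simpa using h1, x, _, rfl⟩, by simp [h3]; omega⟩
    · rintro η ⟨-, h2⟩ γ ⟨h3, x, l, rfl, h1⟩
      simp only [wedgeAct_map, key]
      exact ⟨⟨by simpa using h3, x, _, rfl, h1⟩, trivial⟩

end wedge

section parade
variable {G₀ : Type u} [Group G₀] {X₀ : Type v} [MulAction G₀ᵐᵒᵖ X₀]

/-- The points `x, x g₁, x g₁ g₂, …, x g₁ ⋯ gₙ` all belong to `X`. -/
def IsRoute (X : Set X₀) : X₀ → List G₀ → Prop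
  | x, [] => x ∈ X
  | x, g :: γ => x ∈ X ∧ IsRoute X (x <• g) γ

theorem op_mul_act (x : X₀) (g h : G₀) : x <• (g * h) = (x <• g) <• h := by
  rw [MulOpposite.op_mul, mul_smul]

theorem op_one_act (x : X₀) : x <• (1 : G₀) = x := by
  rw [MulOpposite.op_one, one_smul]

theorem op_inv_act (x : X₀) (g : G₀) : (x <• g) <• g⁻¹ = x := by
  rw [← op_mul_act, mul_inv_cancel, op_one_act]

theorem IsRoute.mem {X : Set X₀} {x : X₀} {γ : List G₀} (h : IsRoute X x γ) : x ∈ X := by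
  cases γ with
  | nil => exact h
  | cons g γ => exact h.1

theorem isRoute_append {X : Set X₀} {x : X₀} {γ δ : List G₀} :
    IsRoute X x (γ ++ δ) ↔ IsRoute X x γ ∧ IsRoute X (x <• γ.prod) δ := by
  induction γ generalizing x with
  | nil =>
    rw [List.nil_append, List.prod_nil, op_one_act]
    exact ⟨fun h => ⟨h.mem, h⟩, fun h => h.2⟩
  | cons g γ ih =>
    rw [List.cons_append, List.prod_cons, op_mul_act]
    simp only [IsRoute, ih, and_assoc]

theorem IsRoute.end_mem {X : Set X₀} {x : X₀} {γ : List G₀} (h : IsRoute X x γ) :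
    x <• γ.prod ∈ X := by
  have : IsRoute X x (γ ++ []) := by simpa using h
  exact (isRoute_append.1 this).2

theorem isRoute_singleton {X : Set X₀} {x : X₀} {g : G₀} :
    IsRoute X x [g] ↔ x ∈ X ∧ x <• g ∈ X := Iff.rfl

theorem isRoute_collapse {X : Set X₀} {x : X₀} {β γ δ : List G₀}
    (h : IsRoute X x (β ++ γ ++ δ)) : IsRoute X x (β ++ γ.prod :: δ) := by
  rw [isRoute_append, isRoute_append] at h
  rw [isRoute_append]
  refine ⟨h.1.1, h.1.2.mem, ?_⟩
  rw [← op_mul_act, ← List.prod_append]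
  exact h.2

theorem isRoute_insert_one {X : Set X₀} {x : X₀} {γ δ : List G₀}
    (h : IsRoute X x (γ ++ δ)) : IsRoute X x (γ ++ 1 :: δ) := by
  have := isRoute_collapse (β := γ) (γ := []) (δ := δ) (by simpa using h)
  simpa using this

theorem prod_invs (γ : List G₀) : ((γ.map (·⁻¹)).reverse).prod = γ.prod⁻¹ :=
  (List.prod_inv_reverse γ).symm

theorem IsRoute.inv {X : Set X₀} {x : X₀} {γ : List G₀} (h : IsRoute X x γ) :
    IsRoute X (x <• γ.prod) ((γ.map (·⁻¹)).reverse) := by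
  induction γ generalizing x with
  | nil => exact h.end_mem
  | cons g γ ih =>
    rw [List.prod_cons, op_mul_act, List.map_cons, List.reverse_cons, isRoute_append, prod_invs]
    refine ⟨ih h.2, ?_⟩
    rw [op_inv_act, isRoute_singleton, op_inv_act]
    exact ⟨h.2.mem, h.1⟩

/-- The elements of the partial group of parades: the `g` with `x g ∈ X` for some `x ∈ X`. -/
abbrev ParadeElt (G₀ : Type u) [Group G₀] {X₀ : Type v} [MulAction G₀ᵐᵒᵖ X₀] (X : Set X₀) :
    Type u :=
  {g : G₀ // ∃ x ∈ X, x <• g ∈ X}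

/-- The parades in `X` of positive length. -/
def paradeDom (G₀ : Type u) [Group G₀] {X₀ : Type v} [MulAction G₀ᵐᵒᵖ X₀] (X : Set X₀) :
    Set (List (ParadeElt G₀ X)) :=
  {γ | γ ≠ [] ∧ ∃ x, IsRoute X x (γ.map Subtype.val)}

theorem paradeOne_mem {X : Set X₀} (hX : X.Nonempty) : ∃ x ∈ X, x <• (1 : G₀) ∈ X := by
  obtain ⟨x, hx⟩ := hX
  exact ⟨x, hx, by rwa [op_one_act]⟩

open Classical in
/-- The product `g₁ ⋯ gₙ` of a parade. -/
noncomputable def paradeProd {X : Set X₀} (hX : X.Nonempty) (γ : List (ParadeElt G₀ X)) :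
    ParadeElt G₀ X :=
  if h : ∃ x ∈ X, x <• (γ.map Subtype.val).prod ∈ X then ⟨(γ.map Subtype.val).prod, h⟩
  else ⟨1, paradeOne_mem hX⟩

theorem paradeProd_val {X : Set X₀} (hX : X.Nonempty) {γ : List (ParadeElt G₀ X)} {x : X₀}
    (h : IsRoute X x (γ.map Subtype.val)) :
    (paradeProd hX γ).1 = (γ.map Subtype.val).prod := by
  rw [paradeProd, dif_pos ⟨x, h.mem, h.end_mem⟩]

/-- The inverse of an element. -/
def paradeInv {X : Set X₀} (g : ParadeElt G₀ X) : ParadeElt G₀ X :=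
  ⟨g.1⁻¹, by
    obtain ⟨x, h1, h2⟩ := g.2
    exact ⟨_, h2, by rwa [op_inv_act]⟩⟩

theorem paradeInv_words {X : Set X₀} (γ : List (ParadeElt G₀ X)) :
    ((γ.map paradeInv).reverse).map Subtype.val =
      ((γ.map Subtype.val).map (·⁻¹)).reverse := by
  simp [paradeInv, List.map_reverse, Function.comp_def]

theorem isRoute_elt {X : Set X₀} (g : ParadeElt G₀ X) :
    ∃ x, IsRoute X x ([g].map Subtype.val) := by
  obtain ⟨x, h1, h2⟩ := g.2
  exact ⟨x, h1, h2⟩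

/-- The partial group of parades in a non-empty subset `X` of a right `G₀`-set `X₀`. -/
@[reducible] noncomputable def parade (G₀ : Type u) [Group G₀] {X₀ : Type v} [MulAction G₀ᵐᵒᵖ X₀]
    (X : Set X₀) (hX : X.Nonempty) : PartialGroup.{u} where
  carrier := ParadeElt G₀ X
  dom := paradeDom G₀ X
  prod := paradeProd hX
  one := ⟨1, paradeOne_mem hX⟩
  inv := paradeInv
  ne_nil := fun h => h.1
  singleton_mem := fun g => ⟨by simp, isRoute_elt g⟩
  prod_singleton := fun g => by
    obtain ⟨x, hx⟩ := isRoute_elt g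
    apply Subtype.ext
    rw [paradeProd_val hX hx]
    simp
  tail_mem := by
    rintro g γ hγ ⟨-, x, h⟩
    exact ⟨hγ, _, h.2⟩
  init_mem := by
    rintro γ g hγ ⟨-, x, h⟩
    rw [List.map_append, isRoute_append] at h
    exact ⟨hγ, _, h.1⟩
  collapse_mem := by
    rintro a b d hb ⟨-, x, h⟩
    rw [List.map_append, List.map_append] at h
    refine ⟨by simp, x, ?_⟩
    rw [List.map_append, List.map_cons,
      paradeProd_val hX (isRoute_append.1 (isRoute_append.1 h).1).2]
    exact isRoute_collapse h
  collapse_prod := by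
    rintro a b d hb ⟨-, x, h⟩
    have h0 := h
    rw [List.map_append, List.map_append] at h
    have h1 := isRoute_collapse h
    have e := paradeProd_val hX (isRoute_append.1 (isRoute_append.1 h).1).2
    apply Subtype.ext
    rw [paradeProd_val hX h0, paradeProd_val hX (x := x)]
    · simp [e]
    · rw [List.map_append, List.map_cons, e]
      exact h1
  insert_one := by
    rintro a b ⟨-, x, h⟩
    rw [List.map_append] at h
    refine ⟨by simp, x, ?_⟩
    rw [List.map_append, List.map_cons]
    exact isRoute_insert_one h
  one_prod := fun g => by
    obtain ⟨x, hx⟩ := isRoute_elt g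
    apply Subtype.ext
    rw [paradeProd_val hX (x := x)]
    · simp
    · exact isRoute_insert_one (γ := []) hx
  prod_one := fun g => by
    obtain ⟨x, hx⟩ := isRoute_elt g
    apply Subtype.ext
    rw [paradeProd_val hX (x := x)]
    · simp
    · exact isRoute_insert_one (γ := [g.1]) (δ := []) hx
  append_inv := by
    rintro γ ⟨hγ, x, h⟩
    refine ⟨by simp [hγ], x, ?_⟩
    rw [List.map_append, paradeInv_words, isRoute_append]
    exact ⟨h, h.inv⟩
  inv_append := by
    rintro γ ⟨hγ, x, h⟩
    refine ⟨by simp [hγ], x <• (γ.map Subtype.val).prod, ?_⟩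
    · rw [List.map_append, paradeInv_words, isRoute_append, prod_invs, op_inv_act]
      exact ⟨h.inv, h⟩
  prod_inv := fun g => by
    obtain ⟨x, hx⟩ := isRoute_elt g
    apply Subtype.ext
    rw [paradeProd_val hX (x := x)]
    · simp [paradeInv]
    · have := (isRoute_append (X := X) (x := x) (γ := [g.1]) (δ := [g.1⁻¹])).2
        ⟨hx, by simpa using hx.inv⟩
      exact this
  inv_prod := fun g => by
    obtain ⟨x, hx⟩ := isRoute_elt g
    apply Subtype.ext
    rw [paradeProd_val hX (x := x <• g.1)]
    · simp [paradeInv]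
    · have := (isRoute_append (X := X) (x := x <• g.1) (γ := [g.1⁻¹]) (δ := [g.1])).2
        ⟨by simpa using hx.inv, by simpa [op_inv_act] using hx⟩
      exact this

/-- `(x | g₁, …, gₙ)` is composable if `g₁, …, gₙ` is a parade with starting point `x`. -/
def routeDom {X : Set X₀} (hX : X.Nonempty) (x : X) (γ : List (parade G₀ X hX).carrier) : Prop :=
  IsRoute X (x : X₀) (γ.map Subtype.val)

open Classical in
/-- The action `x ◁ (g₁, …, gₙ) = x g₁ ⋯ gₙ` of the partial group of parades on `X`. -/
noncomputable def routeAct {X : Set X₀} (hX : X.Nonempty) (x : X)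
    (γ : List (parade G₀ X hX).carrier) : X :=
  if h : (x : X₀) <• (γ.map Subtype.val).prod ∈ X then ⟨_, h⟩ else x

theorem routeAct_val {X : Set X₀} (hX : X.Nonempty) {x : X}
    {γ : List (parade G₀ X hX).carrier} (h : routeDom hX x γ) :
    (routeAct hX x γ : X₀) = (x : X₀) <• (γ.map Subtype.val).prod := by
  have h' : (x : X₀) <• (γ.map Subtype.val).prod ∈ X := IsRoute.end_mem h
  rw [routeAct, dif_pos h']

/-- `X` is a set acted on by the partial group of parades in `X`. -/
theorem routeIsPSet (G₀ : Type u) [Group G₀] {X₀ : Type v} [MulAction G₀ᵐᵒᵖ X₀]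
    {X : Set X₀} (hX : X.Nonempty) :
    IsPSet (parade G₀ X hX) (Set.univ : Set X) (routeDom hX) (routeAct hX) where
  nonempty := ⟨⟨_, hX.some_mem⟩, trivial⟩
  word_mem := fun x _ γ h hγ => ⟨hγ, x, h⟩
  act_mem := fun _ _ _ _ => trivial
  nil_dom := fun x _ => x.2
  nil_act := fun x _ => by
    apply Subtype.ext
    rw [routeAct_val hX (show routeDom hX x [] from x.2)]
    exact op_one_act _
  init_dom := fun x _ γ a h => by
    rw [routeDom, List.map_append, isRoute_append] at h
    exact h.1
  act_dom := fun x _ γ δ h => by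
    rw [routeDom, List.map_append, isRoute_append] at h
    rw [routeDom, routeAct_val hX h.1]
    exact h.2
  act_act := fun x _ γ δ h => by
    have h0 := h
    rw [routeDom, List.map_append, isRoute_append] at h
    apply Subtype.ext
    rw [routeAct_val hX h0, routeAct_val hX, routeAct_val hX h.1, List.map_append,
      List.prod_append, op_mul_act]
    rw [routeDom, routeAct_val hX h.1]
    exact h.2
  collapse_dom := fun x _ β γ δ hγ h => by
    rw [routeDom, List.map_append, List.map_append] at h
    rw [routeDom, List.map_append, List.map_cons]
    have e := paradeProd_val hX (isRoute_append.1 (isRoute_append.1 h).1).2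
    have := isRoute_collapse h
    rw [← e] at this
    exact this
  collapse_act := fun x _ β γ δ hγ h => by
    have h0 := h
    rw [routeDom, List.map_append, List.map_append] at h
    have e : ((parade G₀ X hX).prod γ).1 = _ :=
      paradeProd_val hX (isRoute_append.1 (isRoute_append.1 h).1).2
    have h1 := isRoute_collapse h
    rw [← e] at h1
    apply Subtype.ext
    rw [routeAct_val hX h0, routeAct_val hX]
    · rw [List.map_append, List.map_cons, e]
      simp
    · rw [routeDom, List.map_append, List.map_cons]
      exact h1
  insert_one := fun x _ γ δ h => by
    rw [routeDom, List.map_append] at h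
    rw [routeDom, List.map_append, List.map_cons]
    exact isRoute_insert_one h
  act_one := fun x _ => by
    have h : routeDom hX x [(parade G₀ X hX).one] :=
      isRoute_insert_one (γ := []) (δ := ([] : List G₀)) x.2
    apply Subtype.ext
    rw [routeAct_val hX h, List.map_singleton, List.prod_singleton]
    exact op_one_act _
  append_inv := fun x _ γ h => by
    have e : ((parade G₀ X hX).invWord γ).map Subtype.val =
      ((γ.map Subtype.val).map (·⁻¹)).reverse := paradeInv_words γ
    rw [routeDom, List.map_append, e, isRoute_append]
    exact ⟨h, IsRoute.inv h⟩

/-- `X` is friendly. -/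
theorem routeFriendly (G₀ : Type u) [Group G₀] {X₀ : Type v} [MulAction G₀ᵐᵒᵖ X₀]
    {X : Set X₀} (hX : X.Nonempty) :
    Friendly (parade G₀ X hX) (Set.univ : Set X) (routeDom hX) := by
  rintro γ ⟨-, x, h⟩
  exact ⟨⟨x, h.mem⟩, trivial, h⟩

end parade

end PartialGroup

/-- The points of `ℝᵈ`. -/
abbrev Pt (d : ℕ) : Type := EuclideanSpace ℝ (Fin d)

/-- The Euclidean group `E(d)` of isometries of `ℝᵈ`, acting on the right: the product `a * b` is
`a` followed by `b`. -/
def EuclideanGroup (d : ℕ) : Type := (Pt d ≃ᵃⁱ[ℝ] Pt d)ᵐᵒᵖ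

noncomputable instance (d : ℕ) : Group (EuclideanGroup d) :=
  inferInstanceAs (Group (Pt d ≃ᵃⁱ[ℝ] Pt d)ᵐᵒᵖ)

/-- The isometry of `ℝᵈ` underlying an element of `E(d)`. -/
noncomputable def EuclideanGroup.toIsometry {d : ℕ} (a : EuclideanGroup d) : Pt d ≃ᵃⁱ[ℝ] Pt d :=
  MulOpposite.unop (α := Pt d ≃ᵃⁱ[ℝ] Pt d) a

theorem EuclideanGroup.toIsometry_mul {d : ℕ} (a b : EuclideanGroup d) :
    (a * b).toIsometry = a.toIsometry.trans b.toIsometry := rfl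

theorem EuclideanGroup.toIsometry_one {d : ℕ} :
    (1 : EuclideanGroup d).toIsometry = AffineIsometryEquiv.refl ℝ (Pt d) := rfl

theorem EuclideanGroup.toIsometry_inv {d : ℕ} (a : EuclideanGroup d) :
    (a⁻¹).toIsometry = a.toIsometry.symm := rfl

/-- The right action of `E(d)` on `ℝᵈ`: `x <• a` is the image of `x` under `a`. -/
noncomputable instance (d : ℕ) : MulAction (EuclideanGroup d)ᵐᵒᵖ (Pt d) where
  smul a x := a.unop.toIsometry x
  one_smul _ := rfl
  mul_smul _ _ _ := rfl

/-- The motion group `M(d)` of orientation preserving isometries: the linear part has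
determinant `1`. -/
noncomputable def motionSubgroup (d : ℕ) : Subgroup (EuclideanGroup d) where
  carrier := {a | LinearEquiv.det a.toIsometry.linearIsometryEquiv.toLinearEquiv = 1}
  one_mem' := by
    exact LinearEquiv.det_refl
  mul_mem' := by
    intro a b ha hb
    have e : (a * b).toIsometry.linearIsometryEquiv.toLinearEquiv =
      a.toIsometry.linearIsometryEquiv.toLinearEquiv.trans
        b.toIsometry.linearIsometryEquiv.toLinearEquiv := rfl
    simp only [Set.mem_ofPred_eq] at ha hb ⊢
    rw [e, LinearEquiv.det_trans, ha, hb, one_mul]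
  inv_mem' := by
    intro a ha
    have h : LinearEquiv.det a.toIsometry.linearIsometryEquiv.toLinearEquiv = 1 := ha
    have e : (a⁻¹).toIsometry.linearIsometryEquiv.toLinearEquiv =
      a.toIsometry.linearIsometryEquiv.toLinearEquiv.symm := rfl
    change LinearEquiv.det (a⁻¹).toIsometry.linearIsometryEquiv.toLinearEquiv = 1
    rw [e, ← inv_eq_one, ← map_inv]
    exact h

/-- The motion group `M(d)`. -/
abbrev MotionGroup (d : ℕ) : Type := motionSubgroup d

/-- `M(d)` acts on `ℝᵈ` as a subgroup of `E(d)`. -/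
noncomputable instance (d : ℕ) : MulAction (MotionGroup d)ᵐᵒᵖ (Pt d) where
  smul a x := x <• (a.unop : EuclideanGroup d)
  one_smul _ := rfl
  mul_smul _ _ _ := rfl

/-- The orthogonal group `O(d)` as a subgroup of `E(d)`. -/
noncomputable def orthogonalSubgroup (d : ℕ) : Subgroup (EuclideanGroup d) where
  carrier := {a | ∃ l : Pt d ≃ₗᵢ[ℝ] Pt d, a.toIsometry = l.toAffineIsometryEquiv}
  one_mem' := ⟨LinearIsometryEquiv.refl ℝ (Pt d), rfl⟩
  mul_mem' := by
    rintro a b ⟨l, hl⟩ ⟨m, hm⟩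
    exact ⟨l.trans m, by rw [EuclideanGroup.toIsometry_mul, hl, hm]; rfl⟩
  inv_mem' := by
    rintro a ⟨l, hl⟩
    exact ⟨l.symm, by rw [EuclideanGroup.toIsometry_inv, hl]; rfl⟩

/-- `ℝᵈ` acts on itself on the right by translations (it is written multiplicatively as a group):
`x <• v = x + v`. -/
noncomputable instance (d : ℕ) : MulAction (Multiplicative (Pt d))ᵐᵒᵖ (Pt d) where
  smul v x := x + v.unop.toAdd
  one_smul x := add_zero x
  mul_smul u v x := (add_assoc x v.unop.toAdd u.unop.toAdd).symm

/-- The symmetry group `{a ∈ G₀ | F a = F}` of a subset `F` of a right `G₀`-set. For `G₀ = E(d)`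
and `F ⊆ ℝᵈ` it is `G(F)`, and for `G₀ = M(d)` it is `SG(F)`. -/
def symmetryGroup (G₀ : Type u) [Group G₀] {X₀ : Type v} [MulAction G₀ᵐᵒᵖ X₀] (F : Set X₀) :
    Subgroup G₀ where
  carrier := {a | F <• a = F}
  one_mem' := PartialGroup.op_one_act F
  mul_mem' := by
    intro a b ha hb
    simp only [Set.mem_ofPred_eq] at ha hb ⊢
    rw [PartialGroup.op_mul_act, ha, hb]
  inv_mem' := by
    intro a ha
    simp only [Set.mem_ofPred_eq] at ha ⊢
    conv_lhs => rw [← ha]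
    exact PartialGroup.op_inv_act F a

/-- The set `cc(F)` of connected components of `F ⊆ ℝᵈ`. -/
def components {d : ℕ} (F : Set (Pt d)) : Set (Set (Pt d)) :=
  {K | ∃ x ∈ F, K = connectedComponentIn F x}

theorem components_nonempty {d : ℕ} {F : Set (Pt d)} (hF : F.Nonempty) :
    (components F).Nonempty :=
  ⟨_, hF.some, hF.some_mem, rfl⟩

/-- The symmetry partial group `𝒫(F)` of a non-empty figure `F ⊆ ℝᵈ`. -/
noncomputable def symPartialGroup {d : ℕ} (F : Set (Pt d)) (hF : F.Nonempty) : PartialGroup :=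
  PartialGroup.parade (EuclideanGroup d) (components F) (components_nonempty hF)

/-- The special symmetry partial group `S𝒫(F)` of a non-empty figure `F ⊆ ℝᵈ`. -/
noncomputable def specialSymPartialGroup {d : ℕ} (F : Set (Pt d)) (hF : F.Nonempty) :
    PartialGroup :=
  PartialGroup.parade (MotionGroup d) (components F) (components_nonempty hF)

/-- The partial group `𝒱(P)` of vector parades: its elements are the vectors `y - x` with
`x, y ∈ P`, and its composable words are the `(x₁ - x₀, x₂ - x₁, …, xₙ - xₙ₋₁)` with
`x₀, …, xₙ ∈ P`, that is, the parades in `P` for the group of translations. -/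
@[reducible] noncomputable def vectorParades {d : ℕ} (P : Set (Pt d)) (hP : P.Nonempty) :
    PartialGroup :=
  PartialGroup.parade (Multiplicative (Pt d)) P hP

/-- The action of `𝒱(P)` on the wedge sum of copies of `G` indexed by `P`, induced by the
action of `𝒱(P)` on `P`. -/
noncomputable def paradeWedgeAction {d : ℕ} (P : Set (Pt d)) (hP : P.Nonempty) (G : Type)
    [Group G] : PartialGroup.Action (vectorParades P hP)
      (PartialGroup.wedge P G hP.to_subtype) :=
  PartialGroup.wedgeAction G hP.to_subtype
    (PartialGroup.routeIsPSet (Multiplicative (Pt d)) hP)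
    (PartialGroup.routeFriendly (Multiplicative (Pt d)) hP)

/-- The semidirect product of the wedge sum of copies of `G` indexed by `P` by `𝒱(P)`. -/
noncomputable def paradeSemidirect {d : ℕ} (P : Set (Pt d)) (hP : P.Nonempty) (G : Type)
    [Group G] : PartialGroup :=
  (paradeWedgeAction P hP G).semidirect

/-- The vector `y - x` as an element of `𝒱(P)`. -/
noncomputable def vector {d : ℕ} {P : Set (Pt d)} (hP : P.Nonempty) (x y : P) :
    (vectorParades P hP).carrier :=
  ⟨Multiplicative.ofAdd ((y : Pt d) - x), x, x.2, by
    have e : (x : Pt d) <• Multiplicative.ofAdd ((y : Pt d) - x) = y :=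
      add_sub_cancel (x : Pt d) y
    rw [e]; exact y.2⟩

/-- The element `(y - x) ⋉ [y, a]` of the semidirect product. -/
noncomputable def paradeSemidirect.elt {d : ℕ} {P : Set (Pt d)} (hP : P.Nonempty) {G : Type}
    [Group G] (x y : P) (a : G) : (paradeSemidirect P hP G).carrier :=
  ⟨(vector hP x y, PartialGroup.bracket y a), by
    refine ⟨by simp, y, [a], rfl, y.2, ?_⟩
    have e : (y : Pt d) <• (Multiplicative.ofAdd ((y : Pt d) - x))⁻¹ = x := by
      change (y : Pt d) + -((y : Pt d) - x) = x
      abel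
    exact e ▸ x.2⟩

/-- Every element of the semidirect product is of the form `(y - x) ⋉ [y, a]`. -/
theorem paradeSemidirect.exists_elt {d : ℕ} {P : Set (Pt d)} (hP : P.Nonempty) {G : Type}
    [Group G] (s : (paradeSemidirect P hP G).carrier) :
    ∃ (x y : P) (a : G), s = paradeSemidirect.elt hP x y a := by
  obtain ⟨⟨g, p⟩, h⟩ := s
  obtain ⟨-, y, l, hl, hy⟩ := h
  obtain ⟨a, rfl⟩ : ∃ a, l = [a] := by
    apply List.length_eq_one_iff.1
    simpa using (congrArg List.length hl).symm
  have hx : (y : Pt d) + -(g.1).toAdd ∈ P := hy.2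
  refine ⟨⟨_, hx⟩, y, a, ?_⟩
  apply Subtype.ext
  apply Prod.ext
  · apply Subtype.ext
    change g.1 = Multiplicative.ofAdd ((y : Pt d) - ((y : Pt d) + -(g.1).toAdd))
    simp
  · change p = PartialGroup.bracket y a
    simpa using hl

/-! A motion carrying `F₀ + x` to `F₀ + y` has the form `z ↦ (z - x) a + y` with `a` a symmetry of
`F₀`: undo the translation by `x`, apply `a`, translate by `y`. Sending `(y - x) ⋉ [y, a]` to this
motion gives the map `toParade` from the semidirect product to the partial group of parades in the
set of translates of `F₀`, and the congruence is the kernel of this map. The map is well defined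
although all `[y, 1]` coincide, because for `a = 1` the motion is the translation by `y - x`.

Composable words on both sides are walks. In the semidirect product they are exactly the words `((x₁
- x₀) ⋉ [x₁, a₁], …, (xₙ - xₙ₋₁) ⋉ [xₙ, aₙ])` (`stepWord_mem`, `exists_stepWord`). For such a word
`A(α)` is `([xₙ, a₁], …, [xₙ, aₙ])`, so the product is `(xₙ - x₀) ⋉ [xₙ, a₁ ⋯ aₙ]`
(`prod_stepWord`). The corresponding motions telescope in the same way (`shiftedElt_mul`), whence
`isMap_toParade`. Conversely, a parade through translates lifts to a walk in `P` once a point of `P`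
is chosen for each translate (`exists_lift_toParade`). Lifting of whole composable words, and not
only of elements, is what identifies the target with the quotient by the kernel
(`IsMap.nonempty_iso`).

The explicit form of the congruence comes from comparing two motions `z ↦ (z - x) a + y`
(`ActsByTranslations.shiftedElt_eq_iff`). Only here does it matter that the symmetries of `F₀` are
additive, that is, that `G(F₀)` lies in `O(d)`. Everything is done for a group that contains the
translations and acts faithfully on `ℝᵈ`, then specialised to `E(d)` and `M(d)`. -/

namespace PartialGroup

/-! ### Kernels of maps of partial groups. -/

section kernel

variable {Q : PartialGroup.{u}} {P : PartialGroup.{v}} {φ : Q.carrier → P.carrier}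

/-- The word `(e, e, e⁻¹)` is composable, and bracketing it in the two possible ways gives `1` and
`e`. -/
theorem eq_one_of_prod_self (P : PartialGroup.{u}) {e : P.carrier} (h : [e, e] ∈ P.dom)
    (he : P.prod [e, e] = e) : e = P.one := by
  have h1 := P.append_inv _ h
  have h2 : [e, e, P.inv e] ∈ P.dom := P.left_mem _ [P.inv e] (by simp) (by simpa using h1)
  have e1 := P.collapse_prod [] [e, e] [P.inv e] (by simp) (by simpa using h2)
  have e2 := P.collapse_prod [e] [e, P.inv e] [] (by simp) (by simpa using h2)
  simp only [List.nil_append, List.cons_append, P.prod_inv, P.prod_one, he] at e1 e2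
  exact e2.trans e1.symm

/-- Maps are only required to respect composable words and products. The unit is preserved because
its image is an idempotent. -/
theorem IsMap.map_one (h : IsMap Q P φ) : φ Q.one = P.one := by
  obtain ⟨h1, h2⟩ := h [Q.one, Q.one] (Q.insert_one [] [Q.one] (Q.singleton_mem _))
  rw [Q.one_prod] at h2
  exact P.eq_one_of_prod_self h1 h2

theorem IsMap.map_inv (h : IsMap Q P φ) (a : Q.carrier) : φ (Q.inv a) = P.inv (φ a) := by
  obtain ⟨h1, h2⟩ := h [a, Q.inv a] (Q.append_inv [a] (Q.singleton_mem a))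
  rw [Q.prod_inv, h.map_one] at h2
  exact P.inv_unique _ _ h1 h2

/-- The kernel of a map of partial groups. -/
def IsMap.ker (h : IsMap Q P φ) : Q.Congruence where
  r a b := φ a = φ b
  equiv := ⟨fun _ => rfl, fun h => h.symm, fun h h' => h.trans h'⟩
  prod_rel := fun w w' hw hw' hr => by
    -- Letterwise related words have the same image word, so the images of their products agree.
    rw [← (h w hw).2, ← (h w' hw').2]
    congr 1
    rw [← List.forall₂_eq_eq_eq, List.forall₂_map_left_iff, List.forall₂_map_right_iff]
    exact hr
  inv_rel := fun a b hr => by rw [h.map_inv, h.map_inv, hr]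

/-- A map of partial groups along which composable words lift induces an isomorphism from its
target to the quotient by its kernel. -/
theorem IsMap.nonempty_iso (h : IsMap Q P φ) (hs : ∀ w ∈ P.dom, ∃ t ∈ Q.dom, t.map φ = w) :
    Nonempty (Iso P h.ker.quotient) := by
  let f : Quotient h.ker.setoid → P.carrier := Quotient.lift φ fun _ _ hr => hr
  have hf : Function.Bijective f := by
    constructor
    · intro a b
      induction a using Quotient.inductionOn
      induction b using Quotient.inductionOn
      exact fun hab => Quotient.sound hab
    · intro b
      -- Surjectivity on elements is the lifting property for one-letter words.
      obtain ⟨t, -, ht⟩ := hs [b] (P.singleton_mem b)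
      obtain ⟨a, t, rfl, hb, -⟩ := List.map_eq_cons_iff.1 ht
      exact ⟨h.ker.cls a, hb⟩
  let e := Equiv.ofBijective f hf
  have he : ∀ a, e.symm (φ a) = h.ker.cls a := fun a => e.symm_apply_apply (h.ker.cls a)
  have hf' : ∀ a, e (h.ker.cls a) = φ a := fun a => rfl
  refine ⟨⟨e.symm, ?_, ?_⟩⟩
  · intro w hw
    -- Here whole words must be lifted: composability in the quotient asks for a single composable
    -- word of representatives.
    obtain ⟨t, ht, rfl⟩ := hs w hw
    have hm : (t.map φ).map e.symm = t.map h.ker.cls := by simp [he]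
    rw [hm, (h t ht).2, he]
    exact ⟨⟨t, ht, rfl⟩, h.ker.qprod_map ht⟩
  · rintro w ⟨t, ht, rfl⟩
    have hm : (t.map h.ker.cls).map e = t.map φ := by simp [hf']
    rw [Equiv.symm_symm, hm]
    refine ⟨(h t ht).1, (h t ht).2.trans ?_⟩
    rw [← hf']
    exact congrArg e (h.ker.qprod_map ht).symm

end kernel

end PartialGroup

/-! ### Composable words of the semidirect product as walks in `P`. -/

namespace paradeSemidirect

open PartialGroup

variable {d : ℕ} {P : Set (Pt d)} (hP : P.Nonempty) {G : Type} [Group G]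

/-- The wedge identifies only the brackets `[y, 1]`, so the point `y` can be recovered exactly when
`a ≠ 1`; the first component always remembers just the difference. This is the ambiguity against
which `toParade` has to be well defined. -/
theorem elt_eq_elt {x y x' y' : P} {a a' : G} (h : elt hP x y a = elt hP x' y' a') :
    a = a' ∧ (y : Pt d) - x = y' - x' ∧ (a = 1 ∨ y = y') := by
  have h1 := congrArg (fun s => (s.1.1.1 : Multiplicative (Pt d)).toAdd) h
  have h2 := congrArg (fun s => s.1.2) h
  obtain ⟨h3, h4⟩ := bracket_eq h2
  exact ⟨h3, h1, h4⟩

/-- The last point `xₙ` of the sequence `x₀, x₁, …, xₙ`, where the steps are the `(xᵢ, aᵢ)`. -/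
def endpoint (x₀ : P) : List (P × G) → P
  | [] => x₀
  | s :: l => endpoint s.1 l

/-- The word of the `(xᵢ - xᵢ₋₁) ⋉ [xᵢ, aᵢ]`, where the steps are the `(xᵢ, aᵢ)`. -/
noncomputable def stepWord (x₀ : P) : List (P × G) → List (paradeSemidirect P hP G).carrier
  | [] => []
  | s :: l => elt hP x₀ s.1 s.2 :: stepWord s.1 l

theorem length_stepWord (x₀ : P) (l : List (P × G)) : (stepWord hP x₀ l).length = l.length := by
  induction l generalizing x₀ with
  | nil => rfl
  | cons s l ih => simp [stepWord, ih]

/-- The `𝒱(P)`-components of a word of the semidirect product. -/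
noncomputable abbrev vectors (α : List (paradeSemidirect P hP G).carrier) :
    List (vectorParades P hP).carrier :=
  (paradeWedgeAction P hP G).fsts α

theorem act_vector (x y : P) : (x : Pt d) <• (vector hP x y).1 = y :=
  add_sub_cancel (x : Pt d) y

/-- The differences telescope: translating `x₀` by them successively visits `x₁, …, xₙ`. -/
theorem isRoute_vectors (x₀ : P) (l : List (P × G)) :
    IsRoute P (x₀ : Pt d) ((vectors hP (stepWord hP x₀ l)).map Subtype.val) ∧
      (x₀ : Pt d) <• ((vectors hP (stepWord hP x₀ l)).map Subtype.val).prod =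
        endpoint x₀ l := by
  induction l generalizing x₀ with
  | nil => exact ⟨x₀.2, op_one_act _⟩
  | cons s l ih =>
    obtain ⟨h1, h2⟩ := ih s.1
    change (_ ∧ IsRoute P ((x₀ : Pt d) <• (vector hP x₀ s.1).1) _) ∧
      (x₀ : Pt d) <• ((vector hP x₀ s.1).1 * _) = _
    rw [op_mul_act, act_vector]
    exact ⟨⟨x₀.2, h1⟩, h2⟩

theorem invWord_vals (γ : List (vectorParades P hP).carrier) :
    ((vectorParades P hP).invWord γ).map Subtype.val =
      ((γ.map Subtype.val).map (·⁻¹)).reverse :=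
  paradeInv_words γ

theorem routeDom_invWord (x₀ : P) (l : List (P × G)) :
    routeDom hP (endpoint x₀ l) ((vectorParades P hP).invWord (vectors hP (stepWord hP x₀ l))) := by
  obtain ⟨h1, h2⟩ := isRoute_vectors hP x₀ l
  rw [routeDom, invWord_vals, ← h2]
  exact h1.inv

theorem act_invWord (x₀ : P) (l : List (P × G)) :
    (endpoint x₀ l : Pt d) <• (((vectorParades P hP).invWord
      (vectors hP (stepWord hP x₀ l))).map Subtype.val).prod = x₀ := by
  rw [invWord_vals, prod_invs, ← (isRoute_vectors hP x₀ l).2, op_inv_act]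

/-- The action moves the base point and leaves the group element alone. No domain condition is
needed, since `wedgeAct` and `routeAct` are total and agree on this outside the domain as well. -/
theorem letter_bracket (x : P) (a : G) (γ : List (vectorParades P hP).carrier) :
    (paradeWedgeAction P hP G).letter (bracket x a) γ = bracket (routeAct hP x γ) a := by
  change (wedgeAct G (routeAct hP) ([a].map (bracket x)) γ).headD _ = _
  rw [wedgeAct_map]
  rfl

theorem routeAct_invWord (x₀ : P) (l : List (P × G)) :
    routeAct hP (endpoint x₀ l)
      ((vectorParades P hP).invWord (vectors hP (stepWord hP x₀ l))) = x₀ := by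
  apply Subtype.ext
  rw [routeAct_val hP (routeDom_invWord hP x₀ l), act_invWord]

/-- Walking back from `xₙ` to `xᵢ` turns `[xₙ, aᵢ]` into `[xᵢ, aᵢ]`. This is the form in which
`Action.mem_sdDom` recognises a composable word together with its word `A(α)`. -/
theorem snds_stepWord (x₀ : P) (l : List (P × G)) :
    (paradeWedgeAction P hP G).snds (stepWord hP x₀ l) =
      (paradeWedgeAction P hP G).untwist ((l.map Prod.snd).map (bracket (endpoint x₀ l)))
        (vectors hP (stepWord hP x₀ l)) := by
  induction l generalizing x₀ with
  | nil => rfl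
  | cons s l ih =>
    change bracket s.1 s.2 :: (paradeWedgeAction P hP G).snds (stepWord hP s.1 l) =
      (paradeWedgeAction P hP G).letter (bracket (endpoint s.1 l) s.2)
        ((vectorParades P hP).invWord (vectors hP (stepWord hP s.1 l))) ::
        (paradeWedgeAction P hP G).untwist ((l.map Prod.snd).map (bracket (endpoint s.1 l)))
        (vectors hP (stepWord hP s.1 l))
    rw [← ih, letter_bracket, routeAct_invWord]

/-- In `A(α)` every letter has been transported to the final point `xₙ`, so all letters lie in one
copy of `G` and the reversed walk acts on them. -/
theorem stepWord_mem_twist (x₀ : P) {l : List (P × G)} (hl : l ≠ []) :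
    stepWord hP x₀ l ∈ (paradeSemidirect P hP G).dom ∧
      (paradeWedgeAction P hP G).twist (stepWord hP x₀ l) =
        (l.map Prod.snd).map (bracket (endpoint x₀ l)) :=
  (paradeWedgeAction P hP G).mem_sdDom
    (by rw [List.length_map, List.length_map]; exact (length_stepWord hP x₀ l).symm)
    ⟨by simpa using hl, _, _, rfl, routeDom_invWord hP x₀ l⟩ (snds_stepWord hP x₀ l)

theorem stepWord_mem (x₀ : P) {l : List (P × G)} (hl : l ≠ []) :
    stepWord hP x₀ l ∈ (paradeSemidirect P hP G).dom := (stepWord_mem_twist hP x₀ hl).1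

/-- The vectors telescope to `xₙ - x₀`, while the letters of `A(α)` multiply inside the copy of `G`
at `xₙ`. -/
theorem prod_stepWord (x₀ : P) {l : List (P × G)} (hl : l ≠ []) :
    (paradeSemidirect P hP G).prod (stepWord hP x₀ l) =
      elt hP x₀ (endpoint x₀ l) (l.map Prod.snd).prod := by
  obtain ⟨h1, h2⟩ := stepWord_mem_twist hP x₀ hl
  obtain ⟨h3, h4⟩ := isRoute_vectors hP x₀ l
  apply Subtype.ext
  refine ((paradeWedgeAction P hP G).sdProd_val h1).trans (Prod.ext (Subtype.ext ?_) ?_)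
  · refine (paradeProd_val hP h3).trans ?_
    change _ = Multiplicative.ofAdd ((endpoint x₀ l : Pt d) - x₀)
    rw [← h4]
    exact (add_sub_cancel_left (x₀ : Pt d) _).symm
  · rw [h2]
    exact wedgeProd_map _ _

/-- The walk is recovered from its end: starting at the common base point `w` of `A(α)`, the inverse
vectors lead through points of `P`, and these are the `xₙ, …, x₀` sought. Each second component is
then the corresponding letter of `A(α)` carried back along this path. -/
theorem exists_stepWord_of_untwist (w : P) (l : List G)
    (α : List (paradeSemidirect P hP G).carrier) (hl : l.length = α.length)
    (hw : routeDom hP w ((vectorParades P hP).invWord (vectors hP α)))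
    (he : (paradeWedgeAction P hP G).snds α =
      (paradeWedgeAction P hP G).untwist (l.map (bracket w)) (vectors hP α)) :
    ∃ (x₀ : P) (m : List (P × G)), α = stepWord hP x₀ m ∧ endpoint x₀ m = w := by
  induction α generalizing l with
  | nil => exact ⟨w, [], rfl, rfl⟩
  | cons s α ih =>
    cases l with
    | nil => simp at hl
    | cons a l =>
      have hf : (vectorParades P hP).invWord (vectors hP (s :: α)) =
          (vectorParades P hP).invWord (vectors hP α) ++ [(vectorParades P hP).inv s.1.1] :=
        List.reverse_cons
      rw [hf, routeDom, List.map_append, isRoute_append] at hw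
      have he1 : s.1.2 = (paradeWedgeAction P hP G).letter (bracket w a)
          ((vectorParades P hP).invWord (vectors hP α)) ∧
          (paradeWedgeAction P hP G).snds α =
            (paradeWedgeAction P hP G).untwist (l.map (bracket w)) (vectors hP α) :=
        List.cons.inj he
      -- The tail is now a walk from `y` to `w`, so walking back along it from `w` ends at `y`; one
      -- more inverse vector leads from `y` to the new starting point.
      obtain ⟨y, m, rfl, rfl⟩ := ih l (by simpa using hl) hw.1 he1.2
      rw [letter_bracket, routeAct_invWord] at he1
      rw [act_invWord] at hw
      have hx : (y : Pt d) + -(s.1.1.1).toAdd ∈ P := hw.2.2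
      refine ⟨⟨_, hx⟩, (y, a) :: m, ?_, rfl⟩
      have hs : s = elt hP ⟨_, hx⟩ y a := by
        refine Subtype.ext (Prod.ext (Subtype.ext ?_) he1.1)
        change s.1.1.1 = Multiplicative.ofAdd ((y : Pt d) - ((y : Pt d) + -(s.1.1.1).toAdd))
        simp
      rw [stepWord, ← hs]

/-- Every composable word of the semidirect product is of the form
`((x₁ - x₀) ⋉ [x₁, a₁], …, (xₙ - xₙ₋₁) ⋉ [xₙ, aₙ])`. -/
theorem exists_stepWord {α : List (paradeSemidirect P hP G).carrier}
    (h : α ∈ (paradeSemidirect P hP G).dom) :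
    ∃ (x₀ : P) (l : List (P × G)), l ≠ [] ∧ α = stepWord hP x₀ l := by
  have h0 : α ∈ (paradeWedgeAction P hP G).sdDom := h
  have h1 := (paradeWedgeAction P hP G).snds_eq h0
  -- The domain of the action supplies a base point `w` even if all letters of `A(α)` are the unit
  -- and do not determine one.
  obtain ⟨-, w, l, hl, hw⟩ := h0.2
  rw [hl] at h1
  have hlen : l.length = α.length := by
    have := ((paradeWedgeAction P hP G).length_twist α).symm.trans (congrArg List.length hl)
    exact (this.trans (List.length_map _)).symm
  obtain ⟨x₀, m, rfl, -⟩ := exists_stepWord_of_untwist hP w l α hlen hw h1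
  refine ⟨x₀, m, ?_, rfl⟩
  rintro rfl
  exact (paradeSemidirect P hP G).ne_nil h rfl

end paradeSemidirect

/-! ### Motions obtained from symmetries by translating source and target. -/

section decomposition

open PartialGroup paradeSemidirect

variable {d : ℕ} {M : Type} [Group M]

/-- The element `z ↦ (z - x) a + y` of a group containing the translations. -/
def shiftedElt (t : Multiplicative (Pt d) →* M) (x y : Pt d) (a : M) : M :=
  (t (Multiplicative.ofAdd x))⁻¹ * a * t (Multiplicative.ofAdd y)

/-- The translations at the intermediate point `y` cancel. This mirrors the telescoping product of
the semidirect product. -/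
theorem shiftedElt_mul (t : Multiplicative (Pt d) →* M) (x y z : Pt d) (a b : M) :
    shiftedElt t x y a * shiftedElt t y z b = shiftedElt t x z (a * b) := by
  simp [shiftedElt, mul_assoc]

/-- For the trivial symmetry only the difference of the points matters, in accordance with the
identification of all `[y, 1]`. -/
theorem shiftedElt_one (t : Multiplicative (Pt d) →* M) (x y : Pt d) :
    shiftedElt t x y 1 = t (Multiplicative.ofAdd (y - x)) := by
  rw [shiftedElt, mul_one, ← map_inv, ← map_mul, ← ofAdd_neg, ← ofAdd_add, neg_add_eq_sub]

variable [MulAction Mᵐᵒᵖ (Pt d)]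

/-- `t v` acts as the translation by `v`. -/
def ActsByTranslations (t : Multiplicative (Pt d) →* M) : Prop :=
  ∀ x v : Pt d, x <• t (Multiplicative.ofAdd v) = x + v

theorem ActsByTranslations.act_inv {t : Multiplicative (Pt d) →* M} (ht : ActsByTranslations t)
    (x v : Pt d) : x <• (t (Multiplicative.ofAdd v))⁻¹ = x - v := by
  rw [← map_inv, ← ofAdd_neg, ht, sub_eq_add_neg]

theorem ActsByTranslations.act_shiftedElt {t : Multiplicative (Pt d) →* M}
    (ht : ActsByTranslations t) (z x y : Pt d) (a : M) :
    z <• shiftedElt t x y a = (z - x) <• a + y := by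
  rw [shiftedElt, op_mul_act, op_mul_act, ht.act_inv, ht]

/-- Equality of the motions means `(z - x) a + y = (z - x') a' + y'` for all `z`. By additivity, the
value at `z = x'` gives the condition on the points; subtracting it leaves `z a = z a'` for all `z`,
and faithfulness gives `a = a'`. -/
theorem ActsByTranslations.shiftedElt_eq_iff {t : Multiplicative (Pt d) →* M}
    (ht : ActsByTranslations t) [FaithfulSMul Mᵐᵒᵖ (Pt d)] {a a' : M}
    (ha : ∀ u v : Pt d, (u + v) <• a = u <• a + v <• a)
    (ha' : ∀ u v : Pt d, (u + v) <• a' = u <• a' + v <• a') (x y x' y' : Pt d) :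
    shiftedElt t x y a = shiftedElt t x' y' a' ↔ a = a' ∧ (x' - x) <• a = y' - y := by
  have ext : ∀ {g h : M}, (∀ z : Pt d, z <• g = z <• h) → g = h := fun hgh =>
    MulOpposite.op_injective (FaithfulSMul.eq_of_smul_eq_smul hgh)
  constructor
  · intro h
    -- Evaluating at `z + x'` removes the shift on the right-hand side.
    have h0 : ∀ z : Pt d, z <• a + (x' - x) <• a + y = z <• a' + y' := fun z => by
      have h1 := congrArg (fun g : M => (z + x') <• g) h
      simp only [ht.act_shiftedElt] at h1
      rw [add_sub_assoc, ha, add_sub_cancel_right] at h1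
      exact h1
    have zero : ∀ {b : M}, (∀ u v : Pt d, (u + v) <• b = u <• b + v <• b) →
        (0 : Pt d) <• b = 0 := fun hb => by
      have := hb 0 0
      rw [add_zero] at this
      exact left_eq_add.1 this
    have h1 : (x' - x) <• a = y' - y := by
      have := h0 0
      rw [zero ha, zero ha', zero_add, zero_add] at this
      exact eq_sub_of_add_eq this
    refine ⟨ext fun z => ?_, h1⟩
    have := h0 z
    rw [h1, add_assoc, sub_add_cancel] at this
    exact add_right_cancel this
  · rintro ⟨rfl, h⟩
    refine ext fun z => ?_
    rw [ht.act_shiftedElt, ht.act_shiftedElt]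
    have e : z - x = (z - x') + (x' - x) := (sub_add_sub_cancel _ _ _).symm
    rw [e, ha, h, add_assoc, sub_add_cancel]

/-! ### Translates of a figure and the motions between them. -/

variable {F₀ P : Set (Pt d)} {X : Set (Set (Pt d))}

/-- The translates `F₀ + x`, `x ∈ P`. -/
def translates (F₀ P : Set (Pt d)) : Set (Set (Pt d)) :=
  {K | ∃ x ∈ P, K = {z | ∃ y ∈ F₀, z = y + x}}

theorem ActsByTranslations.act_set {t : Multiplicative (Pt d) →* M} (ht : ActsByTranslations t)
    (F₀ : Set (Pt d)) (x : Pt d) :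
    F₀ <• t (Multiplicative.ofAdd x) = {z | ∃ y ∈ F₀, z = y + x} := by
  ext z
  constructor
  · rintro ⟨y, hy, rfl⟩
    exact ⟨y, hy, ht y x⟩
  · rintro ⟨y, hy, rfl⟩
    exact ⟨y, hy, ht y x⟩

theorem translate_act_shiftedElt (t : Multiplicative (Pt d) →* M) (x y : Pt d)
    (a : symmetryGroup M F₀) :
    (F₀ <• t (Multiplicative.ofAdd x)) <• shiftedElt t x y (a : M) =
      F₀ <• t (Multiplicative.ofAdd y) := by
  have ha : F₀ <• (a : M) = F₀ := a.2
  rw [shiftedElt, ← op_mul_act, mul_assoc, mul_inv_cancel_left, op_mul_act, ha]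

/-- Conjugating back, `F₀ → F₀ + x → F₀ + y → F₀` is a symmetry of `F₀`. With
`translate_act_shiftedElt` this describes all elements carrying one translate to another. -/
theorem exists_eq_shiftedElt (t : Multiplicative (Pt d) →* M) (x y : Pt d) (g : M)
    (h : (F₀ <• t (Multiplicative.ofAdd x)) <• g = F₀ <• t (Multiplicative.ofAdd y)) :
    ∃ a : symmetryGroup M F₀, g = shiftedElt t x y (a : M) := by
  refine ⟨⟨t (Multiplicative.ofAdd x) * g * (t (Multiplicative.ofAdd y))⁻¹, ?_⟩, ?_⟩
  · change F₀ <• _ = F₀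
    rw [op_mul_act, op_mul_act, h, op_inv_act]
  · simp [shiftedElt, mul_assoc]

theorem ActsByTranslations.translate_mem {t : Multiplicative (Pt d) →* M}
    (ht : ActsByTranslations t) (x : P) :
    F₀ <• t (Multiplicative.ofAdd (x : Pt d)) ∈ translates F₀ P :=
  ⟨x, x.2, ht.act_set F₀ x⟩

theorem ActsByTranslations.exists_translate {t : Multiplicative (Pt d) →* M}
    (ht : ActsByTranslations t) {K : Set (Pt d)} (hK : K ∈ translates F₀ P) :
    ∃ x : P, K = F₀ <• t (Multiplicative.ofAdd (x : Pt d)) := by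
  obtain ⟨x, hx, rfl⟩ := hK
  exact ⟨⟨x, hx⟩, (ht.act_set F₀ x).symm⟩

/-! ### The map from the semidirect product to the parades of translates. -/

variable {t : Multiplicative (Pt d) →* M} (ht : ActsByTranslations t) (hP : P.Nonempty)
  (hX : (translates F₀ P).Nonempty)

/-- The element `z ↦ (z - x) a + y` of the partial group of parades. -/
def shiftedParade (x y : P) (a : symmetryGroup M F₀) :
    (parade M (translates F₀ P) hX).carrier :=
  ⟨shiftedElt t (x : Pt d) y (a : M), _, ht.translate_mem x, by
    rw [translate_act_shiftedElt]
    exact ht.translate_mem y⟩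

/-- The map `(y - x) ⋉ [y, a] ↦ (z ↦ (z - x) a + y)`. -/
noncomputable def toParade (s : (paradeSemidirect P hP (symmetryGroup M F₀)).carrier) :
    (parade M (translates F₀ P) hX).carrier :=
  shiftedParade ht hX (exists_elt hP s).choose (exists_elt hP s).choose_spec.choose
    (exists_elt hP s).choose_spec.choose_spec.choose

/-- Makes the choices in `toParade` harmless. There are two ways for representations to agree:
either `a = 1`, where only the difference counts, or the end points coincide, and then so do the
starting points. -/
theorem shiftedParade_eq {x y x' y' : P} {a a' : symmetryGroup M F₀}
    (h : elt hP x y a = elt hP x' y' a') :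
    shiftedParade ht hX x y a = shiftedParade ht hX x' y' a' := by
  obtain ⟨rfl, h1, h2⟩ := elt_eq_elt hP h
  apply Subtype.ext
  change shiftedElt t (x : Pt d) y (a : M) = shiftedElt t (x' : Pt d) y' (a : M)
  rcases h2 with rfl | rfl
  · rw [Subgroup.coe_one, shiftedElt_one, shiftedElt_one, h1]
  · rw [sub_right_injective h1]

theorem toParade_elt (x y : P) (a : symmetryGroup M F₀) :
    toParade ht hP hX (elt hP x y a) = shiftedParade ht hX x y a :=
  (shiftedParade_eq ht hP hX
    (exists_elt hP (elt hP x y a)).choose_spec.choose_spec.choose_spec).symm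

/-- The walk `x₀, …, xₙ` in `P` becomes the walk `F₀ + x₀, …, F₀ + xₙ`, and the motions along it
telescope. -/
theorem isRoute_toParade (x₀ : P) (l : List (P × symmetryGroup M F₀)) :
    IsRoute (translates F₀ P) (F₀ <• t (Multiplicative.ofAdd (x₀ : Pt d)))
        (((stepWord hP x₀ l).map (toParade ht hP hX)).map Subtype.val) ∧
      (l ≠ [] → (((stepWord hP x₀ l).map (toParade ht hP hX)).map Subtype.val).prod =
        shiftedElt t x₀ (endpoint x₀ l : Pt d) ((l.map Prod.snd).prod : symmetryGroup M F₀)) := by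
  induction l generalizing x₀ with
  | nil => exact ⟨ht.translate_mem x₀, fun h => absurd rfl h⟩
  | cons s l ih =>
    obtain ⟨h1, h2⟩ := ih s.1
    rw [stepWord, List.map_cons, List.map_cons, toParade_elt, List.prod_cons]
    refine ⟨⟨ht.translate_mem x₀, ?_⟩, fun _ => ?_⟩
    · have h3 : _ = _ := translate_act_shiftedElt t (x₀ : Pt d) s.1 s.2
      exact h3.symm ▸ h1
    · change shiftedElt t (x₀ : Pt d) s.1 (s.2 : M) * _ = _
      -- The induction hypothesis on products covers only non-empty tails, so a single step is
      -- treated separately.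
      cases l with
      | nil => simp [stepWord, endpoint]
      | cons s' l =>
        rw [h2 (by simp), shiftedElt_mul, ← Subgroup.coe_mul, ← List.prod_cons]
        rfl

/-- By `exists_stepWord` it is enough to consider walks, for which both products have been computed
by telescoping. -/
theorem isMap_toParade : IsMap (paradeSemidirect P hP (symmetryGroup M F₀))
    (parade M (translates F₀ P) hX) (toParade ht hP hX) := by
  intro w hw
  obtain ⟨x₀, l, hl, rfl⟩ := exists_stepWord hP hw
  obtain ⟨h1, h2⟩ := isRoute_toParade ht hP hX x₀ l
  refine ⟨⟨?_, _, h1⟩, ?_⟩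
  · rw [Ne, List.map_eq_nil_iff]
    exact (paradeSemidirect P hP _).ne_nil hw
  · rw [prod_stepWord hP x₀ hl, toParade_elt]
    exact Subtype.ext ((paradeProd_val hX h1).trans (h2 hl))

/-- The lift is built step by step. The point chosen for the translate reached in one step is used
as the starting point of the next, so that the lifted letters fit together to a walk in `P`. -/
theorem exists_stepWord_of_isRoute (x₀ : P) (w : List (parade M (translates F₀ P) hX).carrier)
    (h : IsRoute (translates F₀ P) (F₀ <• t (Multiplicative.ofAdd (x₀ : Pt d)))
      (w.map Subtype.val)) :
    ∃ l, (stepWord hP x₀ l).map (toParade ht hP hX) = w := by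
  induction w generalizing x₀ with
  | nil => exact ⟨[], rfl⟩
  | cons g w ih =>
    rw [List.map_cons] at h
    obtain ⟨-, h⟩ := h
    -- Any representative `y` of the next translate will do; another choice changes the symmetry `a`
    -- accordingly.
    obtain ⟨y, hy⟩ := ht.exists_translate h.mem
    obtain ⟨a, ha⟩ := exists_eq_shiftedElt t (x₀ : Pt d) y g.1 hy
    rw [hy] at h
    obtain ⟨l, hl⟩ := ih y h
    refine ⟨(y, a) :: l, ?_⟩
    rw [stepWord, List.map_cons, hl, toParade_elt]
    congr 1
    exact Subtype.ext ha.symm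

theorem exists_lift_toParade (w : List (parade M (translates F₀ P) hX).carrier)
    (hw : w ∈ (parade M (translates F₀ P) hX).dom) :
    ∃ α ∈ (paradeSemidirect P hP (symmetryGroup M F₀)).dom, α.map (toParade ht hP hX) = w := by
  obtain ⟨hn, K, hK⟩ := hw
  obtain ⟨x₀, rfl⟩ := ht.exists_translate hK.mem
  obtain ⟨l, rfl⟩ := exists_stepWord_of_isRoute ht hP hX x₀ w hK
  refine ⟨_, stepWord_mem hP x₀ ?_, rfl⟩
  rintro rfl
  exact hn rfl

/-- The decomposition of the partial group of parades in the set of translates of a figure whose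
symmetries act additively, for a group which acts faithfully and contains the translations. -/
theorem ActsByTranslations.exists_congruence {t : Multiplicative (Pt d) →* M}
    (ht : ActsByTranslations t) (hP : P.Nonempty) [FaithfulSMul Mᵐᵒᵖ (Pt d)] {X : Set (Set (Pt d))}
    (hXne : X.Nonempty) (hXP : X = translates F₀ P)
    (ha : ∀ a : symmetryGroup M F₀, ∀ u v : Pt d, (u + v) <• (a : M) = u <• (a : M) + v <• (a : M)) :
    ∃ c : (paradeSemidirect P hP (symmetryGroup M F₀)).Congruence,
      (∀ (x y x' y' : P) (a a' : symmetryGroup M F₀),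
        c.r (elt hP x y a) (elt hP x' y' a') ↔
          a = a' ∧ ((x' : Pt d) - x) <• (a : M) = (y' : Pt d) - y) ∧
      Nonempty (Iso (parade M X hXne) c.quotient) := by
  subst hXP
  refine ⟨(isMap_toParade ht hP hXne).ker, fun x y x' y' a a' => ?_,
    (isMap_toParade ht hP hXne).nonempty_iso (exists_lift_toParade ht hP hXne)⟩
  -- The congruence is a kernel, so it remains to compare two motions.
  change toParade ht hP hXne _ = toParade ht hP hXne _ ↔ _
  rw [toParade_elt, toParade_elt, Subtype.ext_iff]
  refine (ht.shiftedElt_eq_iff (ha a) (ha a') x y x' y').trans ?_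
  rw [Subtype.ext_iff]

end decomposition

/-! ### The Euclidean group and the motion group. -/

/-- The translations as elements of the Euclidean group. -/
noncomputable def euclideanTranslation (d : ℕ) : Multiplicative (Pt d) →* EuclideanGroup d where
  toFun v := MulOpposite.op (AffineIsometryEquiv.vaddConst ℝ v.toAdd)
  map_one' := by
    apply MulOpposite.unop_injective
    ext1 x
    exact add_zero x
  map_mul' u v := by
    apply MulOpposite.unop_injective
    ext1 x
    exact (add_assoc x u.toAdd v.toAdd).symm

theorem euclideanTranslation_mem_motionSubgroup (d : ℕ) (v : Multiplicative (Pt d)) :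
    euclideanTranslation d v ∈ motionSubgroup d :=
  LinearEquiv.det_refl

theorem actsByTranslations_euclidean (d : ℕ) : ActsByTranslations (euclideanTranslation d) :=
  fun _ _ => rfl

/-- The translations as elements of the motion group. -/
noncomputable def motionTranslation (d : ℕ) : Multiplicative (Pt d) →* MotionGroup d :=
  (euclideanTranslation d).codRestrict (motionSubgroup d)
    (euclideanTranslation_mem_motionSubgroup d)

theorem actsByTranslations_motion (d : ℕ) : ActsByTranslations (motionTranslation d) :=
  fun _ _ => rfl

instance (d : ℕ) : FaithfulSMul (EuclideanGroup d)ᵐᵒᵖ (Pt d) where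
  eq_of_smul_eq_smul h :=
    MulOpposite.unop_injective (MulOpposite.unop_injective (AffineIsometryEquiv.ext h))

instance (d : ℕ) : FaithfulSMul (MotionGroup d)ᵐᵒᵖ (Pt d) where
  eq_of_smul_eq_smul h := MulOpposite.unop_injective <| Subtype.ext <|
    MulOpposite.op_injective <| FaithfulSMul.eq_of_smul_eq_smul (α := Pt d) fun x => h x

/-- Elements of `O(d)` are their own linear parts; this turns the assumption on `G(F₀)` into the
additivity required by `ActsByTranslations.exists_congruence`. -/
theorem add_act_of_mem_orthogonalSubgroup {d : ℕ} {a : EuclideanGroup d}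
    (h : a ∈ orthogonalSubgroup d) (u v : Pt d) : (u + v) <• a = u <• a + v <• a := by
  obtain ⟨l, hl⟩ := h
  change a.toIsometry (u + v) = a.toIsometry u + a.toIsometry v
  rw [hl]
  exact map_add l u v

theorem theorem12p3 (d : ℕ) (F F₀ P : Set (Pt d)) (hF : F.Nonempty) (hP : P.Nonempty)
    (hcc : components F = {K | ∃ x ∈ P, K = {z | ∃ y ∈ F₀, z = y + x}})
    (hO : symmetryGroup (EuclideanGroup d) F₀ ≤ orthogonalSubgroup d) :
    (∃ c : (paradeSemidirect P hP (symmetryGroup (EuclideanGroup d) F₀)).Congruence,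
      (∀ (x y x' y' : P) (a a' : symmetryGroup (EuclideanGroup d) F₀),
        c.r (paradeSemidirect.elt hP x y a) (paradeSemidirect.elt hP x' y' a') ↔
          a = a' ∧ ((x' : Pt d) - x) <• (a : EuclideanGroup d) = (y' : Pt d) - y) ∧
      Nonempty (PartialGroup.Iso (symPartialGroup F hF) c.quotient)) ∧
    (∃ c : (paradeSemidirect P hP (symmetryGroup (MotionGroup d) F₀)).Congruence,
      (∀ (x y x' y' : P) (a a' : symmetryGroup (MotionGroup d) F₀),
        c.r (paradeSemidirect.elt hP x y a) (paradeSemidirect.elt hP x' y' a') ↔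
          a = a' ∧ ((x' : Pt d) - x) <• (a : MotionGroup d) = (y' : Pt d) - y) ∧
      Nonempty (PartialGroup.Iso (specialSymPartialGroup F hF) c.quotient)) := by
  exact ⟨(actsByTranslations_euclidean d).exists_congruence hP (components_nonempty hF) hcc
      fun a => add_act_of_mem_orthogonalSubgroup (hO a.2),
    -- `M(d)` acts through `E(d)`, so an element of `SG(F₀)` is also one of `G(F₀)` and the
    -- assumption on `G(F₀)` applies to it.
    (actsByTranslations_motion d).exists_congruence hP (components_nonempty hF) hcc
      fun a => add_act_of_mem_orthogonalSubgroup (a := (a : MotionGroup d)) (hO a.2)⟩
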